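/- Let $\mathbb D$ be the open unit disk, $n\ge 1$, let $F=\{\sigma_1,\dots,\sigma_n\}\subset\partial\mathbb D$ consist of $n$ distinct points, $\Lambda=(\lambda_1,\dots,\lambda_n)\in(-\infty,0)^n$ and $\tau\in\partial\mathbb D\setminus F$. A one-parameter semigroup is a family $(\phi_t)_{t\ge0}$ of holomorphic self-maps of $\mathbb D$ with $\phi_0=\mathrm{id}$, $\phi_{s+t}=\phi_s\circ\phi_t$ and $\phi_t(z)\to z$ as $t\to0^+$ for each $z\in\mathbb D$; its infinitesimal generator is the holomorphic $G:\mathbb D\to\mathbb C$ with $\frac{d}{dt}\phi_t(z)=G(\phi_t(z))$ for all $z\in\mathbb D$, $t\ge0$. A point $\sigma\in\partial\mathbb D$ is a boundary regular fixed point (BRFP) of a holomorphic self-map $\varphi$ if the angular limit of $\varphi$ at $\sigma$ is $\sigma$ and the angular derivative $\varphi'(\sigma)=\angle\lim_{z\to\sigma}\frac{\varphi(z)-\sigma}{z-\sigma}$ exists finitely; it is a BRFP of $(\phi_t)$ if it is one of every $\phi_t$, and then the spectral value of $(\phi_t)$ at $\sigma$ is $\angle\lim_{z\to\sigma}\frac{G(z)}{\sigma-z}$.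 A point $\tau\in\partial\mathbb D$ is the Denjoy–Wolff point (DW-point) of $\varphi\ne\mathrm{id}$ if $\varphi$ has no fixed point in $\mathbb D$ and $\tau$ is a BRFP of $\varphi$ with $\varphi'(\tau)\le1$. Let $\mathrm{Gen}_\tau(F,\Lambda)$ be the class of all infinitesimal generators $G$ of one-parameter semigroups $(\phi_t)$ such that $\tau$ is the DW-point of every $\phi_t\neq\mathrm{id}$ and, for each $k$, $\sigma_k$ is a BRFP of $(\phi_t)$ with spectral value in $[\lambda_k,0]$ (so $G\equiv0$ belongs to the class). Each $G\in\mathrm{Gen}_\tau(F,\Lambda)$ has a well-defined spectral value $\lambda(G)\in\mathbb R$ at $\tau$, namely the unique real number with $\phi_t'(\tau)=e^{-\lambda(G)t}$ (angular derivative) for all $t\ge0$. Put $$\alpha_k=\frac{|\tau-\sigma_k|^2}{2|\lambda_k|},\quad p_0(z)=\sum_{k=1}^n\alpha_k\frac{\sigma_k+z}{\sigma_k-z},\quad \ell_\zeta=\frac{\tau}{\zeta}-\sum_{k=1}^n\alpha_k,\quad Z=\Big\{\zeta\in\mathbb C:\Big|\Big(2\tau^{-1}\sum_{k=1}^n\alpha_k\Big)\zeta-1\Big|\le1\Big\}.$$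 **Theorem.** We have $$\{(G(0),\lambda(G))\in\mathbb C\times\mathbb R: G\in\mathrm{Gen}_\tau(F,\Lambda)\}=\{(\zeta,\omega):\zeta\in Z,\ \omega\in I_\zeta\},$$ where: (i) for $\zeta$ in the interior of $Z$, $I_\zeta=[0,\omega_\zeta]$ with $$\omega_\zeta=f\Big(\ell_\zeta+i\sum_{k=1}^n\frac{\mathrm{Im}(\overline{\sigma_k}\tau)}{|\lambda_k|}\Big),\qquad f(w)=\frac{2\,\mathrm{Re}\,w}{|w|^2+2\,\mathrm{Re}\,w\,\sum_{k=1}^n|\lambda_k|^{-1}};$$ (ii) for $\zeta\in\partial Z$, $I_\zeta=\big\{\big(\sum_{k=1}^n|\lambda_k|^{-1}\big)^{-1}\big\}$ if $1/\overline{\zeta}=\sum_{k=1}^n|\lambda_k|^{-1}(\tau-\sigma_k)$, and $I_\zeta=\{0\}$ otherwise (in particular for $\zeta=0$). Moreover, for each $\zeta$ in the interior of $Z$ there is a unique $G\in\mathrm{Gen}_\tau(F,\Lambda)$ with $G(0)=\zeta$ and $\lambda(G)=\omega_\zeta$; it is $$G(z)=\frac{(\tau-z)(1-\overline\tau z)}{\dfrac{\sigma_\zeta+z}{\sigma_\zeta-z}\,\mathrm{Re}\,\ell_\zeta+i\,\mathrm{Im}\,\ell_\zeta+p_0(z)},\qquad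 z\in\mathbb D,$$ where $\sigma_\zeta$ is the unique point of $\partial\mathbb D\setminus\{\tau\}$ for which the denominator vanishes at $z=\tau$. -/

import Mathlib

open Set Filter Topology ComplexConjugate

noncomputable section

namespace HolSemigroup

/-- The open unit disk. -/
def disk : Set ℂ := Metric.ball 0 1

/-- The Stolz region of aperture `M` in the unit disk with vertex at the boundary point `σ`. -/
def stolz (σ : ℂ) (M : ℝ) : Set ℂ := {z | z ∈ disk ∧ ‖z - σ‖ < M * (1 - ‖z‖)}

/-- `f` has the finite angular (non-tangential) limit `l` at the boundary point `σ`. -/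
def HasAngularLimit (f : ℂ → ℂ) (σ l : ℂ) : Prop :=
  ∀ M : ℝ, Tendsto f (𝓝[stolz σ M] σ) (𝓝 l)

/-- `σ` is a boundary fixed point of `φ` (in the sense of angular limits), and the angular
derivative of `φ` at `σ` exists finitely and equals `c`. -/
def HasAngularDerivAtFixed (φ : ℂ → ℂ) (σ c : ℂ) : Prop :=
  ‖σ‖ = 1 ∧ HasAngularLimit φ σ σ ∧ HasAngularLimit (fun z => (φ z - σ) / (z - σ)) σ c

/-- `σ` is a boundary regular fixed point of `φ`. -/
def IsBRFP (φ : ℂ → ℂ) (σ : ℂ) : Prop := ∃ c : ℂ, HasAngularDerivAtFixed φ σ c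

/-- `τ` is the Denjoy-Wolff point of the holomorphic self-map `φ` of the unit disk
(meant for `φ` different from the identity): either `τ` is a fixed point in the disk, or
`φ` has no fixed point in the disk and `τ` is a boundary regular fixed point at which the
angular derivative is at most `1`. -/
def IsDWPoint (φ : ℂ → ℂ) (τ : ℂ) : Prop :=
  (τ ∈ disk ∧ φ τ = τ ∧ ‖deriv φ τ‖ ≤ 1) ∨
  ((∀ z ∈ disk, φ z ≠ z) ∧ ∃ c : ℝ, c ≤ 1 ∧ HasAngularDerivAtFixed φ τ (c : ℂ))

/-- One-parameter semigroups `(φ t)`, `t ≥ 0`, of holomorphic self-maps of the unit disk.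
Only the values `φ t z` with `0 ≤ t` and `z` in the disk are meaningful. -/
structure IsOneParamSemigroup (φ : ℝ → ℂ → ℂ) : Prop where
  holo : ∀ t, 0 ≤ t → DifferentiableOn ℂ (φ t) disk
  mapsTo : ∀ t, 0 ≤ t → MapsTo (φ t) disk disk
  zero : ∀ z ∈ disk, φ 0 z = z
  add : ∀ s t, 0 ≤ s → 0 ≤ t → ∀ z ∈ disk, φ (s + t) z = φ s (φ t z)
  cont : ∀ z ∈ disk, Tendsto (fun t => φ t z) (𝓝[>] (0 : ℝ)) (𝓝 z)

/-- `G` is the infinitesimal generator of `φ`: `G` is holomorphic in the disk and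
`(d/dt) φ t z = G (φ t z)` for all `t ≥ 0` (right derivative at `t = 0`). -/
def IsGeneratorOf (G : ℂ → ℂ) (φ : ℝ → ℂ → ℂ) : Prop :=
  DifferentiableOn ℂ G disk ∧
  ∀ z ∈ disk, ∀ t : ℝ, 0 ≤ t →
    HasDerivWithinAt (fun s => φ s z) (G (φ t z)) (Ici 0) t

/-- `τ` is the Denjoy-Wolff point of every `φ t` different from the identity. The trivial
semigroup satisfies this for every `τ`. -/
def HasDWPoint (φ : ℝ → ℂ → ℂ) (τ : ℂ) : Prop :=
  ∀ t : ℝ, 0 ≤ t → ¬ EqOn (φ t) id disk → IsDWPoint (φ t) τ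

/-- `σ` is a boundary regular fixed point of the semigroup `φ` with generator `G`, and the
spectral value of the semigroup at `σ` is `μ`. -/
def HasBRFPWithSpectralValue (φ : ℝ → ℂ → ℂ) (G : ℂ → ℂ) (σ : ℂ) (μ : ℝ) : Prop :=
  (∀ t : ℝ, 0 ≤ t → IsBRFP (φ t) σ) ∧ HasAngularLimit (fun z => G z / (σ - z)) σ (μ : ℂ)

/-- The class of generators with Denjoy-Wolff point `τ` (including `G ≡ 0`), having boundary
regular fixed points `σ k` with spectral values in `[Λ k, 0]`. -/
def Gen {n : ℕ} (τ : ℂ) (σ : Fin n → ℂ) (Λ : Fin n → ℝ) : Set (ℂ → ℂ) :=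
  {G | ∃ φ : ℝ → ℂ → ℂ, IsOneParamSemigroup φ ∧ IsGeneratorOf G φ ∧ HasDWPoint φ τ ∧
    ∀ k, ∃ μ : ℝ, Λ k ≤ μ ∧ μ ≤ 0 ∧ HasBRFPWithSpectralValue φ G (σ k) μ}

/-- For `τ` on the unit circle: `ω` is the spectral value at `τ` of the semigroup generated
by `G`, that is, the angular derivative of `φ t` at `τ` is `exp (-ω t)` for all `t ≥ 0`. -/
def HasSpectralValueAt (G : ℂ → ℂ) (τ : ℂ) (ω : ℝ) : Prop :=
  ∃ φ : ℝ → ℂ → ℂ, IsOneParamSemigroup φ ∧ IsGeneratorOf G φ ∧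
    ∀ t : ℝ, 0 ≤ t → HasAngularDerivAtFixed (φ t) τ ((Real.exp (-(ω * t)) : ℝ) : ℂ)

/-- The value region of `G ↦ (G 0, λ(G))`. -/
def valueRegion {n : ℕ} (τ : ℂ) (σ : Fin n → ℂ) (Λ : Fin n → ℝ) : Set (ℂ × ℝ) :=
  {v | ∃ G ∈ Gen τ σ Λ, G 0 = v.1 ∧ HasSpectralValueAt G τ v.2}

variable {n : ℕ}

def alpha (τ : ℂ) (σ : Fin n → ℂ) (Λ : Fin n → ℝ) (k : Fin n) : ℝ :=
  ‖τ - σ k‖ ^ 2 / (2 * |Λ k|)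

def sumAlpha (τ : ℂ) (σ : Fin n → ℂ) (Λ : Fin n → ℝ) : ℝ := ∑ k, alpha τ σ Λ k

/-- `∑ 1 / |λ_k|`. -/
def sumInv (Λ : Fin n → ℝ) : ℝ := ∑ k, |Λ k|⁻¹

def p0 (τ : ℂ) (σ : Fin n → ℂ) (Λ : Fin n → ℝ) (z : ℂ) : ℂ :=
  ∑ k, (alpha τ σ Λ k : ℂ) * ((σ k + z) / (σ k - z))

def regionZ (τ : ℂ) (σ : Fin n → ℂ) (Λ : Fin n → ℝ) : Set ℂ :=
  {ζ | ‖(2 * τ⁻¹ * (sumAlpha τ σ Λ : ℂ)) * ζ - 1‖ ≤ 1}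

def ell (τ : ℂ) (σ : Fin n → ℂ) (Λ : Fin n → ℝ) (ζ : ℂ) : ℂ :=
  τ / ζ - (sumAlpha τ σ Λ : ℂ)

def fRatio (Λ : Fin n → ℝ) (w : ℂ) : ℝ :=
  2 * w.re / (‖w‖ ^ 2 + 2 * w.re * sumInv Λ)

/-- The upper end point `ω_ζ`. -/
def omegaMax (τ : ℂ) (σ : Fin n → ℂ) (Λ : Fin n → ℝ) (ζ : ℂ) : ℝ :=
  fRatio Λ (ell τ σ Λ ζ +
    Complex.I * ((∑ k, |Λ k|⁻¹ * (conj (σ k) * τ).im : ℝ) : ℂ))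

/-- The denominator of the extremal generator with parameter `s` on the unit circle. -/
def extrDenom (τ : ℂ) (σ : Fin n → ℂ) (Λ : Fin n → ℝ) (ζ s z : ℂ) : ℂ :=
  (s + z) / (s - z) * ((ell τ σ Λ ζ).re : ℂ) + Complex.I * ((ell τ σ Λ ζ).im : ℂ)
    + p0 τ σ Λ z

def extrGen (τ : ℂ) (σ : Fin n → ℂ) (Λ : Fin n → ℝ) (ζ s z : ℂ) : ℂ :=
  (τ - z) * (1 - conj τ * z) / extrDenom τ σ Λ ζ s z

end HolSemigroup

end

open HolSemigroup

/-!
By Berkson–Porta, a generator with Denjoy–Wolff point `τ` is `G z = (τ - z) (1 - conj τ z) p z`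
with `Re p ≥ 0`. If `p` is not zero, a boundary regular fixed point at `σ k` gives the Herglotz
measure of `1 / p` an atom there, and the bound on the spectral value says that its mass is at least
`α k`. So `1 / p = p0 - p0 τ + h` with `Re h ≥ 0`, where `h 0` is a function of `G 0`; conversely
every such `h` with suitable boundary behaviour gives a member of the class.

Since `p0 τ` is imaginary and `(p0 z - p0 τ) / (1 - conj τ z) → ∑ 1 / |λ_k|` at `τ`, a positive
spectral value `λ` satisfies `1 / λ = ∑ 1 / |λ_k| + β`, where `β` is the angular limit of
`h z / (1 - conj τ z)`. Julia's lemma for `1 / h` bounds `β` below by `1 / (2 Re (1 / h 0))`.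
Equality forces `1 / h` to be a real multiple of the Herglotz kernel at `τ` plus an imaginary
constant, that is, `h z = a (H_s z - H_s τ)` for the Herglotz kernel `H_s` of another boundary point
`s`. Smaller spectral values come from `1 / h = m H_τ + b` with `Re b > 0`, and `λ = 0` from a
constant `h`. On the boundary of `Z` the real part of `h 0` vanishes, so `h` is an imaginary
constant.

A function of Berkson–Porta form generates a semigroup because its Koenigs function, a primitive of
`1 / G`, is injective and its image is invariant under positive translations.
-/

noncomputable section

namespace HolSemigroup

/-! ### The unit disk -/

theorem mem_disk {z : ℂ} : z ∈ disk ↔ ‖z‖ < 1 := mem_ball_zero_iff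

theorem isOpen_disk : IsOpen disk := Metric.isOpen_ball

theorem convex_disk : Convex ℝ disk := convex_ball 0 1

theorem zero_mem_disk : (0 : ℂ) ∈ disk := Metric.mem_ball_self one_pos

theorem one_sub_norm_sq_pos {z : ℂ} (hz : z ∈ disk) : 0 < 1 - ‖z‖ ^ 2 :=
  sub_pos.2 ((sq_lt_one_iff₀ (norm_nonneg z)).2 (mem_disk.1 hz))

theorem ne_zero_of_norm_one {σ : ℂ} (hσ : ‖σ‖ = 1) : σ ≠ 0 :=
  norm_ne_zero_iff.1 (hσ ▸ one_ne_zero)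

theorem conj_mul_self_of_norm_one {σ : ℂ} (hσ : ‖σ‖ = 1) : conj σ * σ = 1 := by
  rw [Complex.conj_mul', hσ, Complex.ofReal_one, one_pow]

theorem sub_ne_zero_of_mem_disk {σ z : ℂ} (hσ : ‖σ‖ = 1) (hz : z ∈ disk) : σ - z ≠ 0 := by
  intro h
  rw [mem_disk, ← sub_eq_zero.1 h, hσ] at hz
  exact lt_irrefl _ hz

theorem one_sub_conj_mul_ne_zero {z w : ℂ} (hz : z ∈ disk) (hw : w ∈ disk) :
    1 - conj w * z ≠ 0 := by
  refine sub_ne_zero_of_mem_disk norm_one (mem_disk.2 ?_)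
  rw [norm_mul, RCLike.norm_conj]
  exact mul_lt_one_of_nonneg_of_lt_one_left (norm_nonneg w) (mem_disk.1 hw) (mem_disk.1 hz).le

theorem one_sub_conj_mul_eq {τ : ℂ} (hτ : ‖τ‖ = 1) (z : ℂ) :
    1 - conj τ * z = conj τ * (τ - z) := by
  rw [mul_sub, conj_mul_self_of_norm_one hτ]

theorem ne_zero_of_re_pos {w : ℂ} (hw : 0 < w.re) : w ≠ 0 := by
  rintro rfl
  exact lt_irrefl _ hw

theorem inv_re_eq_div_norm_sq (w : ℂ) : (w⁻¹).re = w.re / ‖w‖ ^ 2 := by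
  rw [Complex.inv_re, Complex.normSq_eq_norm_sq]

theorem inv_re_pos {w : ℂ} (hw : 0 < w.re) : 0 < (w⁻¹).re := by
  have := norm_pos_iff.2 (ne_zero_of_re_pos hw)
  rw [inv_re_eq_div_norm_sq]
  positivity

theorem eq_of_re_eq_zero {h : ℂ → ℂ} (hd : DifferentiableOn ℂ h disk)
    (hpos : ∀ z ∈ disk, 0 ≤ (h z).re) {z₀ : ℂ} (hz₀ : z₀ ∈ disk) (h0 : (h z₀).re = 0) :
    ∀ z ∈ disk, h z = h z₀ := by
  rcases (hd.analyticOnNhd isOpen_disk).is_constant_or_isOpen convex_disk.isPreconnected with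
    ⟨w, hw⟩ | hopen
  · intro z hz
    rw [hw z hz, hw z₀ hz₀]
  · have him : IsOpen (Complex.re '' (h '' disk)) :=
      Complex.isOpenMap_re _ (hopen disk subset_rfl isOpen_disk)
    have hnonneg : Complex.re '' (h '' disk) ⊆ Ici 0 := by
      rintro _ ⟨_, ⟨z, hz, rfl⟩, rfl⟩
      exact hpos z hz
    have hmem : (0 : ℝ) ∈ interior (Ici 0) :=
      interior_maximal hnonneg him ⟨h z₀, mem_image_of_mem h hz₀, h0⟩
    rw [interior_Ici] at hmem
    exact absurd (mem_Ioi.1 hmem) (lt_irrefl 0)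

theorem re_pos_of_re_zero_pos {h : ℂ → ℂ} (hd : DifferentiableOn ℂ h disk)
    (hpos : ∀ z ∈ disk, 0 ≤ (h z).re) (h0 : 0 < (h 0).re) : ∀ z ∈ disk, 0 < (h z).re := by
  intro z hz
  refine (hpos z hz).lt_of_ne fun hz0 => h0.ne' ?_
  rw [eq_of_re_eq_zero hd hpos hz hz0.symm 0 zero_mem_disk, ← hz0]

/-! ### The Herglotz kernel -/

/-- The Herglotz kernel with pole at the boundary point `σ`, mapping the disk onto the right
half-plane; its real part is the Poisson kernel. -/
def herglotz (σ z : ℂ) : ℂ := (σ + z) / (σ - z)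

theorem herglotz_re {σ : ℂ} (hσ : ‖σ‖ = 1) (z : ℂ) :
    (herglotz σ z).re = (1 - ‖z‖ ^ 2) / ‖σ - z‖ ^ 2 := by
  have hσ' : Complex.normSq σ = 1 := by rw [Complex.normSq_eq_norm_sq, hσ, one_pow]
  rw [herglotz, Complex.div_re, ← Complex.normSq_eq_norm_sq, ← Complex.normSq_eq_norm_sq,
    ← add_div, Complex.normSq_apply z]
  rw [Complex.normSq_apply] at hσ'
  congr 1
  simp only [Complex.add_re, Complex.sub_re, Complex.add_im, Complex.sub_im]
  linear_combination hσ'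

theorem herglotz_re_pos {σ z : ℂ} (hσ : ‖σ‖ = 1) (hz : z ∈ disk) : 0 < (herglotz σ z).re := by
  have hnum := one_sub_norm_sq_pos hz
  have hden := norm_pos_iff.2 (sub_ne_zero_of_mem_disk hσ hz)
  rw [herglotz_re hσ]
  positivity

theorem herglotz_re_boundary {σ z : ℂ} (hσ : ‖σ‖ = 1) (hz : ‖z‖ = 1) : (herglotz σ z).re = 0 := by
  rw [herglotz_re hσ, hz, one_pow, sub_self, zero_div]

theorem herglotz_zero {σ : ℂ} (hσ : ‖σ‖ = 1) : herglotz σ 0 = 1 := by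
  rw [herglotz, add_zero, sub_zero, div_self (ne_zero_of_norm_one hσ)]

theorem hasDerivAt_herglotz {σ z : ℂ} (hz : σ - z ≠ 0) :
    HasDerivAt (herglotz σ) (2 * σ / (σ - z) ^ 2) z := by
  have h := ((hasDerivAt_id z).const_add σ).div ((hasDerivAt_id z).const_sub σ) hz
  refine h.congr_deriv ?_
  simp only [id_eq]
  ring

theorem differentiableOn_herglotz {σ : ℂ} (hσ : ‖σ‖ = 1) : DifferentiableOn ℂ (herglotz σ) disk :=
  fun _ hz => (hasDerivAt_herglotz (sub_ne_zero_of_mem_disk hσ hz)).differentiableAt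
    |>.differentiableWithinAt

theorem continuousAt_herglotz {σ z : ℂ} (hz : σ ≠ z) : ContinuousAt (herglotz σ) z :=
  (hasDerivAt_herglotz (sub_ne_zero.2 hz)).continuousAt

/-! ### Radial approach to a boundary point -/

theorem eventually_mem_Ioo : ∀ᶠ r : ℝ in 𝓝[<] 1, r ∈ Ioo (0 : ℝ) 1 :=
  Ioo_mem_nhdsLT one_pos

theorem tendsto_one_sub_ofReal : Tendsto (fun r : ℝ => ((1 - r : ℝ) : ℂ)) (𝓝[<] 1) (𝓝 0) := by
  have h : Continuous fun r : ℝ => ((1 - r : ℝ) : ℂ) := by fun_prop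
  simpa only [sub_self, Complex.ofReal_zero] using (h.tendsto 1).mono_left nhdsWithin_le_nhds

theorem norm_radial {σ : ℂ} (hσ : ‖σ‖ = 1) {r : ℝ} (hr : r ∈ Ioo (0 : ℝ) 1) :
    ‖(r : ℂ) * σ‖ = r := by
  rw [norm_mul, hσ, mul_one, Complex.norm_real, Real.norm_of_nonneg hr.1.le]

theorem radial_mem_disk {σ : ℂ} (hσ : ‖σ‖ = 1) {r : ℝ} (hr : r ∈ Ioo (0 : ℝ) 1) :
    (r : ℂ) * σ ∈ disk :=
  mem_disk.2 ((norm_radial hσ hr).trans_lt hr.2)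

theorem sub_radial (σ : ℂ) (r : ℝ) : σ - (r : ℂ) * σ = ((1 - r : ℝ) : ℂ) * σ := by
  push_cast; ring

theorem norm_sub_radial {σ : ℂ} (hσ : ‖σ‖ = 1) {r : ℝ} (hr : r ∈ Ioo (0 : ℝ) 1) :
    ‖σ - (r : ℂ) * σ‖ = 1 - r := by
  rw [sub_radial, norm_mul, hσ, mul_one, Complex.norm_real,
    Real.norm_of_nonneg (sub_pos.2 hr.2).le]

theorem tendsto_radial (σ : ℂ) : Tendsto (fun r : ℝ => (r : ℂ) * σ) (𝓝[<] 1) (𝓝 σ) := by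
  have h : Continuous fun r : ℝ => (r : ℂ) * σ := by fun_prop
  simpa only [Complex.ofReal_one, one_mul] using (h.tendsto 1).mono_left nhdsWithin_le_nhds

theorem tendsto_radial_disk {σ : ℂ} (hσ : ‖σ‖ = 1) :
    Tendsto (fun r : ℝ => (r : ℂ) * σ) (𝓝[<] 1) (𝓝[disk] σ) :=
  tendsto_nhdsWithin_iff.2
    ⟨tendsto_radial σ, eventually_mem_Ioo.mono fun _ hr => radial_mem_disk hσ hr⟩

theorem tendsto_radial_stolz {σ : ℂ} (hσ : ‖σ‖ = 1) :
    Tendsto (fun r : ℝ => (r : ℂ) * σ) (𝓝[<] 1) (𝓝[stolz σ 2] σ) := by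
  refine tendsto_nhdsWithin_iff.2 ⟨tendsto_radial σ,
    eventually_mem_Ioo.mono fun r hr => ⟨radial_mem_disk hσ hr, ?_⟩⟩
  rw [norm_sub_rev, norm_sub_radial hσ hr, norm_radial hσ hr]
  linarith [hr.2]

theorem HasAngularLimit.radial {f : ℂ → ℂ} {σ l : ℂ} (h : HasAngularLimit f σ l) (hσ : ‖σ‖ = 1) :
    Tendsto (fun r : ℝ => f (r * σ)) (𝓝[<] 1) (𝓝 l) :=
  (h 2).comp (tendsto_radial_stolz hσ)

theorem HasAngularLimit.congr {f g : ℂ → ℂ} {σ l : ℂ} (h : HasAngularLimit f σ l)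
    (hfg : EqOn f g disk) : HasAngularLimit g σ l :=
  fun M => (h M).congr' (eventually_mem_nhdsWithin.mono fun _ hz => hfg hz.1)

theorem hasAngularLimit_of_tendsto_disk {f : ℂ → ℂ} {σ l : ℂ} (h : Tendsto f (𝓝[disk] σ) (𝓝 l)) :
    HasAngularLimit f σ l :=
  fun _ => h.mono_left (nhdsWithin_mono _ fun _ hz => hz.1)

/-! ### Schwarz–Pick and Julia inequalities -/

theorem norm_sq_add_conj_sub_norm_sq_sub (a b : ℂ) :
    ‖a + conj b‖ ^ 2 - ‖a - b‖ ^ 2 = 4 * a.re * b.re := by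
  simp only [← Complex.normSq_eq_norm_sq, Complex.normSq_apply, Complex.add_re, Complex.sub_re,
    Complex.add_im, Complex.sub_im, Complex.conj_re, Complex.conj_im]
  ring

theorem norm_sq_one_sub_conj_mul_sub_norm_sq_sub (z w : ℂ) :
    ‖1 - conj w * z‖ ^ 2 - ‖z - w‖ ^ 2 = (1 - ‖z‖ ^ 2) * (1 - ‖w‖ ^ 2) := by
  simp only [← Complex.normSq_eq_norm_sq, Complex.normSq_apply, Complex.mul_re, Complex.sub_re,
    Complex.mul_im, Complex.sub_im, Complex.conj_re, Complex.conj_im, Complex.one_re,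
    Complex.one_im]
  ring

/-- The automorphism of the disk sending `w` to the origin, with inverse `mobius (-w)`. -/
def mobius (w z : ℂ) : ℂ := (z - w) / (1 - conj w * z)

theorem mapsTo_mobius {w : ℂ} (hw : w ∈ disk) : MapsTo (mobius w) disk disk := by
  intro z hz
  have hden := norm_pos_iff.2 (one_sub_conj_mul_ne_zero hz hw)
  have hgap := norm_sq_one_sub_conj_mul_sub_norm_sq_sub z w
  have hpos := mul_pos (one_sub_norm_sq_pos hz) (one_sub_norm_sq_pos hw)
  rw [mem_disk, mobius, norm_div, div_lt_one hden]
  exact lt_of_pow_lt_pow_left₀ 2 hden.le (by linarith)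

theorem differentiableOn_mobius {w : ℂ} (hw : w ∈ disk) : DifferentiableOn ℂ (mobius w) disk :=
  (differentiableOn_id.sub_const w).div ((differentiableOn_id.const_mul _).const_sub 1)
    fun _ hz => one_sub_conj_mul_ne_zero hz hw

theorem neg_mem_disk {w : ℂ} (hw : w ∈ disk) : -w ∈ disk :=
  mem_disk.2 ((norm_neg w).trans_lt (mem_disk.1 hw))

theorem mobius_neg_mobius {w z : ℂ} (hw : w ∈ disk) (hz : z ∈ disk) :
    mobius (-w) (mobius w z) = z := by
  have h := one_sub_conj_mul_ne_zero (mapsTo_mobius hw hz) (neg_mem_disk hw)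
  have hmul : mobius w z * (1 - conj w * z) = z - w :=
    div_mul_cancel₀ _ (one_sub_conj_mul_ne_zero hz hw)
  rw [mobius, div_eq_iff h, map_neg]
  linear_combination hmul

theorem norm_le_norm_mobius {f : ℂ → ℂ} (hd : DifferentiableOn ℂ f disk)
    (hm : MapsTo f disk (Metric.closedBall 0 1)) {z w : ℂ} (hz : z ∈ disk) (hw : w ∈ disk)
    (hfw : f w = 0) : ‖f z‖ ≤ ‖mobius w z‖ := by
  have hmap := mapsTo_mobius (neg_mem_disk hw)
  have hzero : (f ∘ mobius (-w)) 0 = 0 := by simp [mobius, hfw]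
  have h := Complex.norm_le_norm_of_mapsTo_ball
    (hd.comp (differentiableOn_mobius (neg_mem_disk hw)) hmap) (hm.comp hmap) hzero
    (mem_disk.1 (mapsTo_mobius hw hz))
  rwa [Function.comp_apply, mobius_neg_mobius hw hz] at h

theorem norm_sub_mul_le {h : ℂ → ℂ} (hd : DifferentiableOn ℂ h disk)
    (hpos : ∀ z ∈ disk, 0 ≤ (h z).re) {z w : ℂ} (hz : z ∈ disk) (hw : w ∈ disk) :
    ‖h z - h w‖ * ‖1 - conj w * z‖ ≤ ‖z - w‖ * ‖h z + conj (h w)‖ := by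
  rcases (hpos w hw).eq_or_lt with hw0 | hw0
  · rw [eq_of_re_eq_zero hd hpos hw hw0.symm z hz, sub_self, norm_zero, zero_mul]
    positivity
  have hre : ∀ ζ ∈ disk, 0 < (h ζ + conj (h w)).re := fun ζ hζ => by
    rw [Complex.add_re, Complex.conj_re]
    exact add_pos_of_nonneg_of_pos (hpos ζ hζ) hw0
  have hne : ∀ ζ ∈ disk, h ζ + conj (h w) ≠ 0 := fun ζ hζ => ne_zero_of_re_pos (hre ζ hζ)
  have hmaps : MapsTo (fun ζ => (h ζ - h w) / (h ζ + conj (h w))) disk (Metric.closedBall 0 1) := by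
    intro ζ hζ
    have hgap := norm_sq_add_conj_sub_norm_sq_sub (h ζ) (h w)
    have := mul_nonneg (hpos ζ hζ) hw0.le
    rw [mem_closedBall_zero_iff, norm_div, div_le_one (norm_pos_iff.2 (hne ζ hζ))]
    exact le_of_sq_le_sq (by linarith) (norm_nonneg _)
  have hschwarz := norm_le_norm_mobius ((hd.sub_const _).div (hd.add_const _) hne) hmaps hz hw
    (by simp)
  rwa [mobius, Pi.div_apply, norm_div, norm_div, div_le_div_iff₀ (norm_pos_iff.2 (hne z hz))
    (norm_pos_iff.2 (one_sub_conj_mul_ne_zero hz hw))] at hschwarz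

theorem mul_norm_sq_add_conj_le {h : ℂ → ℂ} (hd : DifferentiableOn ℂ h disk)
    (hpos : ∀ z ∈ disk, 0 ≤ (h z).re) {z w : ℂ} (hz : z ∈ disk) (hw : w ∈ disk) :
    (1 - ‖z‖ ^ 2) * (1 - ‖w‖ ^ 2) * ‖h z + conj (h w)‖ ^ 2 ≤
      4 * (h z).re * (h w).re * ‖1 - conj w * z‖ ^ 2 := by
  have hsq := pow_le_pow_left₀ (by positivity) (norm_sub_mul_le hd hpos hz hw) 2
  rw [← norm_sq_add_conj_sub_norm_sq_sub, ← norm_sq_one_sub_conj_mul_sub_norm_sq_sub]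
  linarith

theorem mul_norm_deriv_le {h : ℂ → ℂ} (hd : DifferentiableOn ℂ h disk)
    (hpos : ∀ z ∈ disk, 0 ≤ (h z).re) {w : ℂ} (hw : w ∈ disk) :
    (1 - ‖w‖ ^ 2) * ‖deriv h w‖ ≤ 2 * (h w).re := by
  have hderiv := (hd.differentiableAt (isOpen_disk.mem_nhds hw)).hasDerivAt
  have hslope := (hasDerivAt_iff_tendsto_slope.1 hderiv).norm
  have hz : Tendsto (fun z : ℂ => z) (𝓝[≠] w) (𝓝 w) := nhdsWithin_le_nhds
  have hleft := hslope.mul ((hz.const_mul (conj w)).const_sub 1).norm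
  have hright := ((hderiv.continuousAt.tendsto.comp hz).add_const (conj (h w))).norm
  have hle := le_of_tendsto_of_tendsto hleft hright (by
    filter_upwards [self_mem_nhdsWithin, hz.eventually (isOpen_disk.mem_nhds hw)] with z hne hzd
    have hzw := norm_pos_iff.2 (sub_ne_zero.2 hne)
    rw [slope_def_field, norm_div, div_mul_eq_mul_div, div_le_iff₀' hzw]
    exact norm_sub_mul_le hd hpos hzd hw)
  have hconj : ‖1 - conj w * w‖ = 1 - ‖w‖ ^ 2 := by
    rw [Complex.conj_mul', ← Complex.ofReal_pow, ← Complex.ofReal_one, ← Complex.ofReal_sub,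
      Complex.norm_real, Real.norm_of_nonneg (one_sub_norm_sq_pos hw).le]
  rwa [Complex.add_conj, Complex.norm_real, Real.norm_of_nonneg (by linarith [hpos w hw]), hconj,
    mul_comm] at hle

theorem one_sub_norm_mul_norm_le {h : ℂ → ℂ} (hd : DifferentiableOn ℂ h disk)
    (hpos : ∀ z ∈ disk, 0 ≤ (h z).re) {z : ℂ} (hz : z ∈ disk) :
    (1 - ‖z‖) * ‖h z‖ ≤ (1 + ‖z‖) * ‖h 0‖ := by
  have hpick := norm_sub_mul_le hd hpos hz zero_mem_disk
  rw [map_zero, zero_mul, sub_zero, norm_one, mul_one, sub_zero] at hpick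
  have hadd : ‖h z + conj (h 0)‖ ≤ ‖h z‖ + ‖h 0‖ :=
    (norm_add_le _ _).trans_eq (by rw [RCLike.norm_conj])
  have := mul_le_mul_of_nonneg_left hadd (norm_nonneg z)
  linarith [norm_sub_norm_le (h z) (h 0)]

theorem tendsto_one_sub_conj_radial_mul (σ z : ℂ) :
    Tendsto (fun r : ℝ => 1 - conj (r * σ) * z) (𝓝[<] 1) (𝓝 (1 - conj σ * z)) :=
  (((Complex.continuous_conj.tendsto σ).comp (tendsto_radial σ)).mul_const z).const_sub 1

theorem re_herglotz_mul_norm_sq_le_of_radial {h : ℂ → ℂ} {σ : ℂ} (hσ : ‖σ‖ = 1)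
    (hd : DifferentiableOn ℂ h disk) (hpos : ∀ z ∈ disk, 0 ≤ (h z).re)
    (hzero : Tendsto (fun r : ℝ => h (r * σ)) (𝓝[<] 1) (𝓝 0)) {e : ℝ → ℝ} {D : ℝ}
    (he : Tendsto e (𝓝[<] 1) (𝓝 D)) (hle : ∀ᶠ r : ℝ in 𝓝[<] 1, (h (r * σ)).re ≤ (1 - r) * e r)
    {z : ℂ} (hz : z ∈ disk) : (herglotz σ z).re * ‖h z‖ ^ 2 ≤ 2 * D * (h z).re := by
  have hr : Tendsto (fun r : ℝ => r) (𝓝[<] 1) (𝓝 1) := nhdsWithin_le_nhds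
  have hleft := ((hr.const_add 1).const_mul (1 - ‖z‖ ^ 2)).mul
    ((((Complex.continuous_conj.tendsto 0).comp hzero).const_add (h z)).norm.pow 2)
  have hright := (he.const_mul (4 * (h z).re)).mul
    ((tendsto_one_sub_conj_radial_mul σ z).norm.pow 2)
  have hlim := le_of_tendsto_of_tendsto hleft hright (by
    filter_upwards [eventually_mem_Ioo, hle] with r hr hler
    have hpick := mul_norm_sq_add_conj_le hd hpos hz (radial_mem_disk hσ hr)
    have h4 : 0 ≤ 4 * (h z).re := by linarith [hpos z hz]
    rw [norm_radial hσ hr] at hpick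
    refine le_of_mul_le_mul_left ?_ (sub_pos.2 hr.2)
    calc (1 - r) * ((1 - ‖z‖ ^ 2) * (1 + r) * ‖h z + conj (h (r * σ))‖ ^ 2)
        = (1 - ‖z‖ ^ 2) * (1 - r ^ 2) * ‖h z + conj (h (r * σ))‖ ^ 2 := by ring
      _ ≤ 4 * (h z).re * (h (r * σ)).re * ‖1 - conj (r * σ) * z‖ ^ 2 := hpick
      _ ≤ 4 * (h z).re * ((1 - r) * e r) * ‖1 - conj (r * σ) * z‖ ^ 2 := by gcongr
      _ = _ := by ring)
  have hden := norm_pos_iff.2 (sub_ne_zero_of_mem_disk hσ hz)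
  rw [map_zero, add_zero, one_sub_conj_mul_eq hσ, norm_mul, RCLike.norm_conj, hσ, one_mul] at hlim
  rw [herglotz_re hσ, div_mul_eq_mul_div, div_le_iff₀ (by positivity)]
  linarith

theorem mul_re_herglotz_le_of_radial {q : ℂ → ℂ} {σ : ℂ} (hσ : ‖σ‖ = 1)
    (hd : DifferentiableOn ℂ q disk) (hpos : ∀ z ∈ disk, 0 ≤ (q z).re) {m : ℝ}
    (hlim : Tendsto (fun r : ℝ => ((1 - r : ℝ) : ℂ) * q (r * σ)) (𝓝[<] 1) (𝓝 ((2 * m : ℝ) : ℂ)))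
    {z : ℂ} (hz : z ∈ disk) : m * (herglotz σ z).re ≤ (q z).re := by
  rcases le_or_gt m 0 with hm | hm
  · exact (mul_nonpos_of_nonpos_of_nonneg hm (herglotz_re_pos hσ hz).le).trans (hpos z hz)
  have hr : Tendsto (fun r : ℝ => r) (𝓝[<] 1) (𝓝 1) := nhdsWithin_le_nhds
  have hone := tendsto_one_sub_ofReal.mul_const (q z)
  have hleft := ((hr.const_add 1).const_mul (1 - ‖z‖ ^ 2)).mul
    ((hone.add ((Complex.continuous_conj.tendsto _).comp hlim)).norm.pow 2)
  have hright := (((Complex.continuous_re.tendsto _).comp hlim).const_mul (4 * (q z).re)).mul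
    ((tendsto_one_sub_conj_radial_mul σ z).norm.pow 2)
  have hle := le_of_tendsto_of_tendsto hleft hright (by
    filter_upwards [eventually_mem_Ioo] with r hr
    have hpick := mul_norm_sq_add_conj_le hd hpos hz (radial_mem_disk hσ hr)
    have hr1 := sub_pos.2 hr.2
    rw [norm_radial hσ hr] at hpick
    simp only [Function.comp_apply, map_mul (starRingEnd ℂ) ((1 - r : ℝ) : ℂ),
      Complex.conj_ofReal, ← mul_add, norm_mul ((1 - r : ℝ) : ℂ), Complex.norm_real,
      Real.norm_of_nonneg hr1.le, Complex.re_ofReal_mul]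
    calc (1 - ‖z‖ ^ 2) * (1 + r) * ((1 - r) * ‖q z + conj (q (r * σ))‖) ^ 2
        = (1 - r) * ((1 - ‖z‖ ^ 2) * (1 - r ^ 2) * ‖q z + conj (q (r * σ))‖ ^ 2) := by ring
      _ ≤ (1 - r) * (4 * (q z).re * (q (r * σ)).re * ‖1 - conj (r * σ) * z‖ ^ 2) := by gcongr
      _ = _ := by ring)
  have hden := norm_pos_iff.2 (sub_ne_zero_of_mem_disk hσ hz)
  rw [zero_mul, zero_add, Complex.conj_ofReal, Complex.norm_real,
    Real.norm_of_nonneg (by positivity), Complex.ofReal_re, one_sub_conj_mul_eq hσ, norm_mul,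
    RCLike.norm_conj, hσ, one_mul] at hle
  rw [herglotz_re hσ, ← mul_div_assoc, div_le_iff₀ (by positivity)]
  refine le_of_mul_le_mul_left ?_ (show 0 < 8 * m by positivity)
  linarith

theorem sum_mul_re_herglotz_le_of_radial {ι : Type*} {q : ℂ → ℂ} {σ : ι → ℂ} {m : ι → ℝ}
    (hσ : ∀ k, ‖σ k‖ = 1) (hinj : Function.Injective σ) (hd : DifferentiableOn ℂ q disk)
    (hpos : ∀ z ∈ disk, 0 ≤ (q z).re)
    (hlim : ∀ k, Tendsto (fun r : ℝ => ((1 - r : ℝ) : ℂ) * q (r * σ k)) (𝓝[<] 1)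
      (𝓝 ((2 * m k : ℝ) : ℂ))) (s : Finset ι) :
    ∀ z ∈ disk, 0 ≤ (q z - ∑ k ∈ s, (m k : ℂ) * herglotz (σ k) z).re := by
  classical
  induction s using Finset.induction_on with
  | empty => simpa using hpos
  | insert a s ha ih =>
    intro z hz
    have hcont : ContinuousAt (fun z => ∑ k ∈ s, (m k : ℂ) * herglotz (σ k) z) (σ a) :=
      tendsto_finsetSum _ fun k hk =>
        (continuousAt_herglotz (hinj.ne (ne_of_mem_of_not_mem hk ha))).const_mul (m k : ℂ)
    have hsum := tendsto_one_sub_ofReal.mul (hcont.tendsto.comp (tendsto_radial (σ a)))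
    have hdiff : DifferentiableOn ℂ (fun z => q z - ∑ k ∈ s, (m k : ℂ) * herglotz (σ k) z) disk :=
      hd.sub (DifferentiableOn.fun_sum fun k _ => (differentiableOn_herglotz (hσ k)).const_mul _)
    have hsub := (hlim a).sub hsum
    simp only [Function.comp_apply, zero_mul, sub_zero, ← mul_sub] at hsub
    have hle := mul_re_herglotz_le_of_radial (hσ a) hdiff ih hsub hz
    rw [Finset.sum_insert ha, add_comm, ← sub_sub, Complex.sub_re, Complex.re_ofReal_mul]
    exact sub_nonneg.2 hle


/-! ### Angular derivatives at a boundary fixed point -/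

/-- The growth bound on `q` keeps `(1 - r) * q (r * σ)` bounded, so it cannot compensate a factor
tending to zero: this is Hopf's lemma for functions with nonnegative real part. -/
theorem ne_zero_of_tendsto_radial_mul {q : ℂ → ℂ} {σ : ℂ} (hσ : ‖σ‖ = 1)
    (hd : DifferentiableOn ℂ q disk) (hpos : ∀ z ∈ disk, 0 ≤ (q z).re) {g : ℝ → ℂ} {b l : ℂ}
    (hg : Tendsto g (𝓝[<] 1) (𝓝 b)) (hl : l ≠ 0)
    (hmul : Tendsto (fun r : ℝ => ((1 - r : ℝ) : ℂ) * q (r * σ) * g r) (𝓝[<] 1) (𝓝 l)) :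
    b ≠ 0 := by
  rintro rfl
  have hbound : ∀ᶠ r : ℝ in 𝓝[<] 1,
      ‖((1 - r : ℝ) : ℂ) * q (r * σ) * g r‖ ≤ 2 * ‖q 0‖ * ‖g r‖ := by
    filter_upwards [eventually_mem_Ioo] with r hr
    have hgrowth := one_sub_norm_mul_norm_le hd hpos (radial_mem_disk hσ hr)
    have hr2 : 1 + r ≤ 2 := by linarith [hr.2]
    rw [norm_radial hσ hr] at hgrowth
    rw [norm_mul, norm_mul, Complex.norm_real, Real.norm_of_nonneg (sub_pos.2 hr.2).le]
    exact mul_le_mul_of_nonneg_right (hgrowth.trans (by gcongr)) (norm_nonneg _)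
  have hzero : Tendsto (fun r => 2 * ‖q 0‖ * ‖g r‖) (𝓝[<] 1) (𝓝 0) := by
    simpa only [norm_zero, mul_zero] using hg.norm.const_mul (2 * ‖q 0‖)
  exact hl (tendsto_nhds_unique hmul (squeeze_zero_norm' hbound hzero))

theorem tendsto_radial_div {q : ℂ → ℂ} {σ : ℂ} (hσ : ‖σ‖ = 1) (hd : DifferentiableOn ℂ q disk)
    (hpos : ∀ z ∈ disk, 0 ≤ (q z).re) {g : ℝ → ℂ} {b l : ℂ} (hg : Tendsto g (𝓝[<] 1) (𝓝 b))
    (hl : l ≠ 0)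
    (hmul : Tendsto (fun r : ℝ => ((1 - r : ℝ) : ℂ) * q (r * σ) * g r) (𝓝[<] 1) (𝓝 l)) :
    Tendsto (fun r : ℝ => ((1 - r : ℝ) : ℂ) * q (r * σ)) (𝓝[<] 1) (𝓝 (l / b)) := by
  have hb := ne_zero_of_tendsto_radial_mul hσ hd hpos hg hl hmul
  refine (hmul.div hg hb).congr' ?_
  filter_upwards [hg.eventually_ne hb] with r hr
  exact mul_div_cancel_right₀ _ hr

section AngularDerivative

variable {φ : ℂ → ℂ} {τ : ℂ} {c : ℝ}

theorem differentiableOn_herglotz_comp (hτ : ‖τ‖ = 1) (hd : DifferentiableOn ℂ φ disk)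
    (hm : MapsTo φ disk disk) : DifferentiableOn ℂ (fun z => herglotz τ (φ z)) disk :=
  (differentiableOn_herglotz hτ).comp hd hm

theorem tendsto_radial_herglotz_comp_mul (hm : MapsTo φ disk disk)
    (h : HasAngularDerivAtFixed φ τ c) :
    Tendsto (fun r : ℝ => ((1 - r : ℝ) : ℂ) * herglotz τ (φ (r * τ)) *
      ((φ (r * τ) - τ) / (r * τ - τ))) (𝓝[<] 1) (𝓝 2) := by
  obtain ⟨hτ, hlim, -⟩ := h
  have hτ0 := ne_zero_of_norm_one hτ
  have hsum := ((hlim.radial hτ).const_add τ).div_const τ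
  rw [← two_mul, mul_div_cancel_right₀ _ hτ0] at hsum
  refine hsum.congr' ?_
  filter_upwards [eventually_mem_Ioo] with r hr
  have hne := sub_ne_zero_of_mem_disk hτ (hm (radial_mem_disk hτ hr))
  have hr1 : ((1 - r : ℝ) : ℂ) ≠ 0 := Complex.ofReal_ne_zero.2 (sub_pos.2 hr.2).ne'
  rw [herglotz, ← neg_sub τ, ← neg_sub τ, neg_div_neg_eq, sub_radial]
  generalize φ (r * τ) = w at hne ⊢
  field_simp

theorem tendsto_radial_herglotz_comp (hd : DifferentiableOn ℂ φ disk) (hm : MapsTo φ disk disk)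
    (h : HasAngularDerivAtFixed φ τ c) :
    Tendsto (fun r : ℝ => ((1 - r : ℝ) : ℂ) * herglotz τ (φ (r * τ))) (𝓝[<] 1)
      (𝓝 ((2 * c⁻¹ : ℝ) : ℂ)) := by
  have hlim := tendsto_radial_div h.1 (differentiableOn_herglotz_comp h.1 hd hm)
    (fun z hz => (herglotz_re_pos h.1 (hm hz)).le) (h.2.2.radial h.1) two_ne_zero
    (tendsto_radial_herglotz_comp_mul hm h)
  rwa [div_eq_mul_inv, ← Complex.ofReal_inv, ← Complex.ofReal_ofNat, ← Complex.ofReal_mul] at hlim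

theorem angularDeriv_pos (hd : DifferentiableOn ℂ φ disk) (hm : MapsTo φ disk disk)
    (h : HasAngularDerivAtFixed φ τ c) : 0 < c := by
  have hne := ne_zero_of_tendsto_radial_mul h.1 (differentiableOn_herglotz_comp h.1 hd hm)
    (fun z hz => (herglotz_re_pos h.1 (hm hz)).le) (h.2.2.radial h.1) two_ne_zero
    (tendsto_radial_herglotz_comp_mul hm h)
  have hre := (Complex.continuous_re.tendsto _).comp (tendsto_radial_herglotz_comp hd hm h)
  have hnonneg := ge_of_tendsto hre (b := 0) (by
    filter_upwards [eventually_mem_Ioo] with r hr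
    rw [Function.comp_apply, Complex.re_ofReal_mul]
    exact mul_nonneg (sub_pos.2 hr.2).le (herglotz_re_pos h.1 (hm (radial_mem_disk h.1 hr))).le)
  rw [Complex.ofReal_re, mul_nonneg_iff_of_pos_left two_pos, inv_nonneg] at hnonneg
  exact hnonneg.lt_of_ne' (Complex.ofReal_ne_zero.1 hne)

theorem re_herglotz_le_of_angularDeriv (hd : DifferentiableOn ℂ φ disk) (hm : MapsTo φ disk disk)
    (h : HasAngularDerivAtFixed φ τ c) {z : ℂ} (hz : z ∈ disk) :
    (herglotz τ z).re ≤ c * (herglotz τ (φ z)).re := by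
  have hjulia := mul_re_herglotz_le_of_radial h.1 (differentiableOn_herglotz_comp h.1 hd hm)
    (fun z hz => (herglotz_re_pos h.1 (hm hz)).le) (tendsto_radial_herglotz_comp hd hm h) hz
  exact (inv_mul_le_iff₀ (angularDeriv_pos hd hm h)).1 hjulia

theorem herglotz_radial_re {r : ℝ} (hτ : ‖τ‖ = 1) (hr : r ∈ Ioo (0 : ℝ) 1) :
    (1 - r) * (herglotz τ (r * τ)).re = 1 + r := by
  have := (sub_pos.2 hr.2).ne'
  rw [herglotz_re hτ, norm_radial hτ hr, norm_sub_radial hτ hr]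
  field_simp
  ring

theorem angularDeriv_le (hd : DifferentiableOn ℂ φ disk) (hm : MapsTo φ disk disk)
    (h : HasAngularDerivAtFixed φ τ c) {K : ℝ}
    (hK : ∀ z ∈ disk, (herglotz τ z).re ≤ K * (herglotz τ (φ z)).re) : c ≤ K := by
  have hid : Tendsto (fun r : ℝ => r) (𝓝[<] 1) (𝓝 1) := nhdsWithin_le_nhds
  have hre := (Complex.continuous_re.tendsto _).comp (tendsto_radial_herglotz_comp hd hm h)
  have hlim := le_of_tendsto_of_tendsto (hid.const_add 1) (hre.const_mul K) (by
    filter_upwards [eventually_mem_Ioo] with r hr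
    rw [← herglotz_radial_re h.1 hr, Function.comp_apply, Complex.re_ofReal_mul, mul_left_comm]
    exact mul_le_mul_of_nonneg_left (hK _ (radial_mem_disk h.1 hr)) (sub_pos.2 hr.2).le)
  have hc := angularDeriv_pos hd hm h
  rw [Complex.ofReal_re, ← div_eq_mul_inv, mul_div_assoc', le_div_iff₀ hc] at hlim
  linarith

theorem tendsto_radial_image_stolz (hd : DifferentiableOn ℂ φ disk) (hm : MapsTo φ disk disk)
    (h : HasAngularDerivAtFixed φ τ c) :
    Tendsto (fun r : ℝ => φ (r * τ)) (𝓝[<] 1) (𝓝[stolz τ 4] τ) := by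
  have hτ := h.1
  have hc := angularDeriv_pos hd hm h
  have hnorm := (h.2.2.radial hτ).norm
  rw [Complex.norm_real, Real.norm_of_nonneg hc.le] at hnorm
  refine tendsto_nhdsWithin_iff.2 ⟨h.2.1.radial hτ, ?_⟩
  filter_upwards [eventually_mem_Ioo, hnorm.eventually (lt_mem_nhds (half_lt_self hc))]
    with r hr hlt
  have hz := radial_mem_disk hτ hr
  have hw := mem_disk.1 (hm hz)
  have hr1 := sub_pos.2 hr.2
  have hne := norm_pos_iff.2 (sub_ne_zero_of_mem_disk hτ (hm hz))
  have hjulia := mul_le_mul_of_nonneg_left (re_herglotz_le_of_angularDeriv hd hm h hz) hr1.le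
  rw [herglotz_radial_re hτ hr, herglotz_re hτ, ← mul_div_assoc, ← mul_div_assoc,
    le_div_iff₀ (by positivity)] at hjulia
  rw [norm_div, norm_sub_rev, norm_sub_rev (r * τ), norm_sub_radial hτ hr, lt_div_iff₀ hr1] at hlt
  refine ⟨hm hz, ?_⟩
  rw [norm_sub_rev]
  refine lt_of_mul_lt_mul_right ?_ hne.le
  calc ‖τ - φ (r * τ)‖ * ‖τ - φ (r * τ)‖
      ≤ (1 + r) * ‖τ - φ (r * τ)‖ ^ 2 := by
        rw [← pow_two]
        exact le_mul_of_one_le_left (by positivity) (by linarith [hr.1])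
    _ ≤ (1 - r) * (c * (1 - ‖φ (r * τ)‖ ^ 2)) := hjulia
    _ = c / 2 * (1 - r) * (2 * ((1 + ‖φ (r * τ)‖) * (1 - ‖φ (r * τ)‖))) := by ring
    _ < ‖τ - φ (r * τ)‖ * (2 * ((1 + ‖φ (r * τ)‖) * (1 - ‖φ (r * τ)‖))) := by
        have := mul_pos (by positivity : 0 < 1 + ‖φ (r * τ)‖) (sub_pos.2 hw)
        gcongr
    _ ≤ ‖τ - φ (r * τ)‖ * (2 * (2 * (1 - ‖φ (r * τ)‖))) := by
        have := (sub_pos.2 hw).le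
        gcongr
        linarith
    _ = _ := by ring

theorem angularDeriv_comp {ψ χ : ℂ → ℂ} {a b c : ℝ} (hd : DifferentiableOn ℂ φ disk)
    (hm : MapsTo φ disk disk) (ha : HasAngularDerivAtFixed φ τ a)
    (hb : HasAngularDerivAtFixed ψ τ b) (hc : HasAngularDerivAtFixed χ τ c)
    (hχ : EqOn χ (ψ ∘ φ) disk) : c = b * a := by
  have hτ := ha.1
  have hmul := ((hb.2.2 4).comp (tendsto_radial_image_stolz hd hm ha)).mul (ha.2.2.radial hτ)
  rw [← Complex.ofReal_mul] at hmul
  refine Complex.ofReal_injective (tendsto_nhds_unique (hc.2.2.radial hτ) (hmul.congr' ?_))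
  filter_upwards [eventually_mem_Ioo] with r hr
  have hz := radial_mem_disk hτ hr
  have hne : φ (r * τ) - τ ≠ 0 :=
    sub_ne_zero.2 (sub_ne_zero.1 (sub_ne_zero_of_mem_disk hτ (hm hz))).symm
  rw [hχ hz]
  exact div_mul_div_cancel₀ hne

end AngularDerivative

theorem eq_mul_of_additive_of_nonneg {f : ℝ → ℝ} (hnonneg : ∀ t, 0 ≤ t → 0 ≤ f t)
    (hadd : ∀ s t, 0 ≤ s → 0 ≤ t → f (s + t) = f s + f t) {t : ℝ} (ht : 0 ≤ t) :
    f t = f 1 * t := by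
  have hmono : ∀ s t, 0 ≤ s → s ≤ t → f s ≤ f t := fun s t hs hst => by
    have := hadd s (t - s) hs (sub_nonneg.2 hst)
    rw [add_sub_cancel] at this
    linarith [hnonneg (t - s) (sub_nonneg.2 hst)]
  have hnat : ∀ (N : ℕ) (s : ℝ), 0 ≤ s → f (N * s) = N * f s := fun N s hs => by
    induction N with
    | zero =>
      have := hadd 0 0 le_rfl le_rfl
      rw [add_zero] at this
      rw [Nat.cast_zero, zero_mul, zero_mul]
      linarith
    | succ N ih =>
      push_cast
      rw [add_mul, one_mul, hadd _ _ (by positivity) hs, ih]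
      ring
  have hbound : ∀ N : ℕ, |f t - f 1 * t| * N ≤ f 1 := fun N => by
    have hNt : 0 ≤ (N : ℝ) * t := by positivity
    have hfloor := Nat.floor_le hNt
    have hceil := (Nat.lt_floor_add_one ((N : ℝ) * t)).le
    have hlower := hmono _ _ (Nat.cast_nonneg _) hfloor
    have hupper := hmono _ _ hNt hceil
    have hk := hnat ⌊(N : ℝ) * t⌋₊ 1 zero_le_one
    have hk1 := hnat (⌊(N : ℝ) * t⌋₊ + 1) 1 zero_le_one
    push_cast at hk1
    rw [mul_one] at hk hk1
    rw [hk, hnat N t ht] at hlower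
    rw [hk1, hnat N t ht] at hupper
    have hfloor_mul := mul_le_mul_of_nonneg_right hfloor (hnonneg 1 zero_le_one)
    have hceil_mul := mul_le_mul_of_nonneg_right hceil (hnonneg 1 zero_le_one)
    rw [← Nat.abs_cast N, ← abs_mul, abs_le]
    constructor <;> linarith
  by_contra hne
  obtain ⟨N, hN⟩ := exists_nat_gt (f 1 / |f t - f 1 * t|)
  rw [div_lt_iff₀' (abs_pos.2 (sub_ne_zero.2 hne))] at hN
  exact (hbound N).not_gt hN

theorem exists_exp_of_multiplicative {c : ℝ → ℝ} (hpos : ∀ t, 0 ≤ t → 0 < c t)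
    (hle : ∀ t, 0 ≤ t → c t ≤ 1) (hmul : ∀ s t, 0 ≤ s → 0 ≤ t → c (s + t) = c s * c t) :
    ∃ ω : ℝ, 0 ≤ ω ∧ ∀ t, 0 ≤ t → c t = Real.exp (-(ω * t)) := by
  have hnonneg : ∀ t, 0 ≤ t → 0 ≤ -Real.log (c t) := fun t ht =>
    neg_nonneg.2 (Real.log_nonpos (hpos t ht).le (hle t ht))
  refine ⟨-Real.log (c 1), hnonneg 1 zero_le_one, fun t ht => ?_⟩
  rw [← eq_mul_of_additive_of_nonneg (f := fun t => -Real.log (c t)) hnonneg ?_ ht,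
    neg_neg, Real.exp_log (hpos t ht)]
  intro s t hs ht
  rw [hmul s t hs ht, Real.log_mul (hpos s hs).ne' (hpos t ht).ne', neg_add]


/-! ### The Berkson–Porta function of a generator -/

/-- The function `p` in the Berkson–Porta formula `G z = (τ - z) * (1 - conj τ * z) * p z`;
generators with Denjoy–Wolff point `τ` are those for which its real part is nonnegative. -/
def berksonPorta (τ : ℂ) (G : ℂ → ℂ) (z : ℂ) : ℂ := G z / ((τ - z) * (1 - conj τ * z))

theorem conj_ne_zero_of_norm_one {τ : ℂ} (hτ : ‖τ‖ = 1) : conj τ ≠ 0 :=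
  (map_ne_zero _).2 (ne_zero_of_norm_one hτ)

theorem porta_factor_ne_zero {τ z : ℂ} (hτ : ‖τ‖ = 1) (hz : z ∈ disk) :
    (τ - z) * (1 - conj τ * z) ≠ 0 := by
  have := sub_ne_zero_of_mem_disk hτ hz
  rw [one_sub_conj_mul_eq hτ]
  exact mul_ne_zero this (mul_ne_zero (conj_ne_zero_of_norm_one hτ) this)

theorem porta_factor_eq {τ σ : ℂ} (hσ : ‖σ‖ = 1) :
    (τ - σ) * (1 - conj τ * σ) = -(σ * ((‖τ - σ‖ ^ 2 : ℝ) : ℂ)) := by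
  rw [← Complex.normSq_eq_norm_sq, ← Complex.mul_conj, map_sub]
  linear_combination (σ - τ) * conj_mul_self_of_norm_one hσ

theorem differentiableOn_berksonPorta {τ : ℂ} (hτ : ‖τ‖ = 1) {G : ℂ → ℂ}
    (hG : DifferentiableOn ℂ G disk) : DifferentiableOn ℂ (berksonPorta τ G) disk :=
  hG.div (by fun_prop) fun _ hz => porta_factor_ne_zero hτ hz

theorem tendsto_radial_berksonPorta_div {τ σ : ℂ} (hσ : ‖σ‖ = 1) (hne : τ ≠ σ) {G : ℂ → ℂ} {μ : ℝ}
    (h : HasAngularLimit (fun z => G z / (σ - z)) σ μ) :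
    Tendsto (fun r : ℝ => berksonPorta τ G (r * σ) / ((1 - r : ℝ) : ℂ)) (𝓝[<] 1)
      (𝓝 ((-μ / ‖τ - σ‖ ^ 2 : ℝ) : ℂ)) := by
  have hσ0 := ne_zero_of_norm_one hσ
  have hdist := Complex.ofReal_ne_zero.2 (norm_ne_zero_iff.2 (sub_ne_zero.2 hne))
  have hfactor : (τ - σ) * (1 - conj τ * σ) ≠ 0 := by
    rw [porta_factor_eq hσ, Complex.ofReal_pow]
    exact neg_ne_zero.2 (mul_ne_zero hσ0 (pow_ne_zero 2 hdist))
  have hlim := ((h.radial hσ).mul_const σ).div (((tendsto_radial σ).const_sub τ).mul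
    (((tendsto_radial σ).const_mul (conj τ)).const_sub 1)) hfactor
  have hvalue : (μ : ℂ) * σ / ((τ - σ) * (1 - conj τ * σ)) = ((-μ / ‖τ - σ‖ ^ 2 : ℝ) : ℂ) := by
    rw [porta_factor_eq hσ]
    push_cast
    field_simp
  rw [hvalue] at hlim
  refine hlim.congr' ?_
  filter_upwards [eventually_mem_Ioo] with r hr
  have hr1 : ((1 - r : ℝ) : ℂ) ≠ 0 := Complex.ofReal_ne_zero.2 (sub_pos.2 hr.2).ne'
  rw [Pi.div_apply, berksonPorta, sub_radial]
  field_simp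

theorem hasDerivWithinAt_herglotz_comp {v : ℝ → ℂ} {G : ℂ → ℂ} {τ : ℂ} {s : Set ℝ} {t : ℝ}
    (hτ : ‖τ‖ = 1) (hv : v t ∈ disk) (hd : HasDerivWithinAt v (G (v t)) s t) :
    HasDerivWithinAt (fun t => herglotz τ (v t)) (2 * berksonPorta τ G (v t)) s t := by
  have hne := sub_ne_zero_of_mem_disk hτ hv
  have hconj := conj_ne_zero_of_norm_one hτ
  refine ((hasDerivAt_herglotz hne).comp_hasDerivWithinAt t hd).congr_deriv ?_
  rw [berksonPorta, one_sub_conj_mul_eq hτ]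
  field_simp
  linear_combination G (v t) * conj_mul_self_of_norm_one hτ

theorem hasDerivWithinAt_re {f : ℝ → ℂ} {f' : ℂ} {s : Set ℝ} {t : ℝ}
    (hf : HasDerivWithinAt f f' s t) : HasDerivWithinAt (fun t => (f t).re) f'.re s t :=
  (Complex.reCLM.hasFDerivAt (x := f t)).comp_hasDerivWithinAt t hf

theorem hasDerivWithinAt_exp_mul_re_herglotz {v : ℝ → ℂ} {G : ℂ → ℂ} {τ : ℂ} {s : Set ℝ} {t : ℝ}
    (hτ : ‖τ‖ = 1) (hv : v t ∈ disk) (hd : HasDerivWithinAt v (G (v t)) s t) (ω : ℝ) :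
    HasDerivWithinAt (fun t => Real.exp (-(ω * t)) * (herglotz τ (v t)).re)
      (Real.exp (-(ω * t)) * (2 * (berksonPorta τ G (v t)).re - ω * (herglotz τ (v t)).re))
      s t := by
  have hexp := (((hasDerivAt_id t).const_mul ω).neg.exp).hasDerivWithinAt (s := s)
  refine (hexp.mul (hasDerivWithinAt_re (hasDerivWithinAt_herglotz_comp hτ hv hd))).congr_deriv ?_
  rw [← Complex.ofReal_ofNat, Complex.re_ofReal_mul]
  simp only [id_eq, Pi.neg_apply]
  ring

section SpectralValue

variable {G : ℂ → ℂ} {τ : ℂ} {ω : ℝ}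

theorem mul_re_herglotz_le_berksonPorta (h : HasSpectralValueAt G τ ω) {z : ℂ} (hz : z ∈ disk) :
    ω * (herglotz τ z).re ≤ 2 * (berksonPorta τ G z).re := by
  obtain ⟨φ, hφ, hG, hc⟩ := h
  have h0 : φ 0 z = z := hφ.zero z hz
  have hderiv := hasDerivWithinAt_exp_mul_re_herglotz (v := fun t => φ t z) (hc 0 le_rfl).1
    (hφ.mapsTo 0 le_rfl hz) (hG.2 z hz 0 le_rfl) ω
  have hmin : IsMinOn (fun t => Real.exp (-(ω * t)) * (herglotz τ (φ t z)).re) (Ici 0) 0 := by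
    intro t ht
    simpa [h0] using re_herglotz_le_of_angularDeriv (hφ.holo t ht) (hφ.mapsTo t ht) (hc t ht) hz
  have hnonneg := hmin.localize.hasFDerivWithinAt_nonneg hderiv.hasFDerivWithinAt
    (mem_posTangentConeAt_of_segment_subset (y := 1)
      ((convex_Ici (0 : ℝ)).segment_subset self_mem_Ici (by simp)))
  simpa [h0] using hnonneg

theorem monotoneOn_exp_mul_re_herglotz {v : ℝ → ℂ} {s : Set ℝ} {m : ℝ} (hτ : ‖τ‖ = 1)
    (hs : Convex ℝ s) (hv : ∀ t ∈ s, v t ∈ disk)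
    (hd : ∀ t ∈ s, HasDerivWithinAt v (G (v t)) s t)
    (hm : ∀ z ∈ disk, m * (herglotz τ z).re ≤ 2 * (berksonPorta τ G z).re) :
    MonotoneOn (fun t => Real.exp (-(m * t)) * (herglotz τ (v t)).re) s := by
  have hderiv : ∀ t ∈ s, _ := fun t ht =>
    hasDerivWithinAt_exp_mul_re_herglotz hτ (hv t ht) (hd t ht) m
  exact monotoneOn_of_hasDerivWithinAt_nonneg hs (fun t ht => (hderiv t ht).continuousWithinAt)
    (fun t ht => (hderiv t (interior_subset ht)).mono interior_subset)
    fun t ht => mul_nonneg (Real.exp_pos _).le (sub_nonneg.2 (hm _ (hv t (interior_subset ht))))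

theorem le_spectralValue {m : ℝ} (h : HasSpectralValueAt G τ ω)
    (hm : ∀ z ∈ disk, m * (herglotz τ z).re ≤ 2 * (berksonPorta τ G z).re) : m ≤ ω := by
  obtain ⟨φ, hφ, hG, hc⟩ := h
  have hle := angularDeriv_le (hφ.holo 1 zero_le_one) (hφ.mapsTo 1 zero_le_one) (hc 1 zero_le_one)
    (K := Real.exp (-m)) fun z hz => by
      have := monotoneOn_exp_mul_re_herglotz (v := fun t => φ t z) (hc 0 le_rfl).1 (convex_Ici 0)
        (fun t ht => hφ.mapsTo t ht hz) (hG.2 z hz) hm self_mem_Ici (mem_Ici.2 zero_le_one)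
        zero_le_one
      simpa [hφ.zero z hz] using this
  rw [Real.exp_le_exp] at hle
  linarith

theorem HasSpectralValueAt.unique {ω' : ℝ} (h : HasSpectralValueAt G τ ω)
    (h' : HasSpectralValueAt G τ ω') : ω = ω' :=
  (le_spectralValue h' fun _ hz => mul_re_herglotz_le_berksonPorta h hz).antisymm
    (le_spectralValue h fun _ hz => mul_re_herglotz_le_berksonPorta h' hz)

end SpectralValue

theorem hasAngularDerivAtFixed_of_eqOn_id {φ : ℂ → ℂ} {τ : ℂ} (hτ : ‖τ‖ = 1)
    (hid : EqOn φ id disk) : HasAngularDerivAtFixed φ τ 1 := by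
  refine ⟨hτ, hasAngularLimit_of_tendsto_disk ?_, hasAngularLimit_of_tendsto_disk ?_⟩
  · exact (tendsto_id.mono_left nhdsWithin_le_nhds).congr'
      (eventually_mem_nhdsWithin.mono fun z hz => (hid hz).symm)
  · refine tendsto_const_nhds.congr' (eventually_mem_nhdsWithin.mono fun z hz => ?_)
    have hne := sub_ne_zero.2 (sub_ne_zero.1 (sub_ne_zero_of_mem_disk hτ hz)).symm
    simp only [hid hz, id_eq, div_self hne]

section Generators

variable {n : ℕ} {τ : ℂ} {σ : Fin n → ℂ} {Λ : Fin n → ℝ} {G : ℂ → ℂ}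

theorem exists_spectralValue (hτ : ‖τ‖ = 1) (hG : G ∈ Gen τ σ Λ) :
    ∃ ω : ℝ, 0 ≤ ω ∧ HasSpectralValueAt G τ ω := by
  obtain ⟨φ, hφ, hgen, hdw, -⟩ := hG
  have hex : ∀ t, 0 ≤ t → ∃ c : ℝ, c ≤ 1 ∧ HasAngularDerivAtFixed (φ t) τ (c : ℂ) := by
    intro t ht
    by_cases hid : EqOn (φ t) id disk
    · exact ⟨1, le_rfl, by simpa using hasAngularDerivAtFixed_of_eqOn_id hτ hid⟩
    · rcases hdw t ht hid with ⟨hmem, -⟩ | ⟨-, h⟩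
      · exact absurd hτ (mem_disk.1 hmem).ne
      · exact h
  choose! c hc1 hc using hex
  obtain ⟨ω, hω, hωc⟩ := exists_exp_of_multiplicative (c := c)
    (fun t ht => angularDeriv_pos (hφ.holo t ht) (hφ.mapsTo t ht) (hc t ht)) hc1
    fun s t hs ht => angularDeriv_comp (hφ.holo t ht) (hφ.mapsTo t ht) (hc t ht) (hc s hs)
      (hc _ (add_nonneg hs ht)) (hφ.add s t hs ht)
  exact ⟨ω, hω, φ, hφ, hgen, fun t ht => hωc t ht ▸ hc t ht⟩

theorem differentiableOn_of_mem_gen (hG : G ∈ Gen τ σ Λ) : DifferentiableOn ℂ G disk := by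
  obtain ⟨_, -, hgen, -⟩ := hG
  exact hgen.1

theorem berksonPorta_re_nonneg (hτ : ‖τ‖ = 1) (hG : G ∈ Gen τ σ Λ) :
    ∀ z ∈ disk, 0 ≤ (berksonPorta τ G z).re := by
  obtain ⟨ω, hω, h⟩ := exists_spectralValue hτ hG
  intro z hz
  have := mul_re_herglotz_le_berksonPorta h hz
  have := mul_nonneg hω (herglotz_re_pos hτ hz).le
  linarith

theorem eq_zero_or_berksonPorta_re_pos (hn : 1 ≤ n) (hτ : ‖τ‖ = 1) (hσ : ∀ k, ‖σ k‖ = 1)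
    (hτσ : ∀ k, τ ≠ σ k) (hG : G ∈ Gen τ σ Λ) :
    (∀ z ∈ disk, G z = 0) ∨ ∀ z ∈ disk, 0 < (berksonPorta τ G z).re := by
  have hpos := berksonPorta_re_nonneg hτ hG
  have hd := differentiableOn_berksonPorta hτ (differentiableOn_of_mem_gen hG)
  obtain ⟨φ, -, -, -, hk⟩ := hG
  refine or_iff_not_imp_right.2 fun hall => ?_
  push Not at hall
  obtain ⟨z₀, hz₀, h0⟩ := hall
  have hconst := eq_of_re_eq_zero hd hpos hz₀ (h0.antisymm (hpos z₀ hz₀))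
  let k : Fin n := ⟨0, hn⟩
  obtain ⟨μ, -, -, -, hμ⟩ := hk k
  have hlim := (tendsto_radial_berksonPorta_div (hσ k) (hτσ k) hμ).mul tendsto_one_sub_ofReal
  rw [mul_zero] at hlim
  have hzero : berksonPorta τ G z₀ = 0 := by
    refine tendsto_nhds_unique tendsto_const_nhds (hlim.congr' ?_)
    filter_upwards [eventually_mem_Ioo] with r hr
    rw [div_mul_cancel₀ _ (Complex.ofReal_ne_zero.2 (sub_pos.2 hr.2).ne'),
      hconst _ (radial_mem_disk (hσ k) hr)]
  intro z hz
  have hz0 := (hconst z hz).trans hzero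
  exact (div_eq_zero_iff.1 hz0).resolve_right (porta_factor_ne_zero hτ hz)

theorem spectralValue_neg_and_tendsto_radial_inv_berksonPorta {s : ℂ} (hs : ‖s‖ = 1) (hτs : τ ≠ s)
    (hd : DifferentiableOn ℂ (berksonPorta τ G) disk)
    (hpos : ∀ z ∈ disk, 0 < (berksonPorta τ G z).re) {μ : ℝ} (hμ0 : μ ≤ 0)
    (hμ : HasAngularLimit (fun z => G z / (s - z)) s μ) :
    μ < 0 ∧ Tendsto (fun r : ℝ => ((1 - r : ℝ) : ℂ) * (berksonPorta τ G (r * s))⁻¹) (𝓝[<] 1)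
      (𝓝 ((2 * (‖τ - s‖ ^ 2 / (2 * -μ)) : ℝ) : ℂ)) := by
  have hlim := tendsto_radial_berksonPorta_div hs hτs hμ
  have hdinv : DifferentiableOn ℂ (fun z => (berksonPorta τ G z)⁻¹) disk :=
    hd.inv fun z hz => ne_zero_of_re_pos (hpos z hz)
  have hposinv : ∀ z ∈ disk, 0 ≤ ((berksonPorta τ G z)⁻¹).re := fun z hz =>
    (inv_re_pos (hpos z hz)).le
  have hone : Tendsto (fun r : ℝ => ((1 - r : ℝ) : ℂ) * (berksonPorta τ G (r * s))⁻¹ *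
      (berksonPorta τ G (r * s) / ((1 - r : ℝ) : ℂ))) (𝓝[<] 1) (𝓝 1) := by
    refine tendsto_const_nhds.congr' ?_
    filter_upwards [eventually_mem_Ioo] with r hr
    have hp := ne_zero_of_re_pos (hpos _ (radial_mem_disk hs hr))
    have hr1 : ((1 - r : ℝ) : ℂ) ≠ 0 := Complex.ofReal_ne_zero.2 (sub_pos.2 hr.2).ne'
    field_simp
  have hne := ne_zero_of_tendsto_radial_mul hs hdinv hposinv hlim one_ne_zero hone
  have hneg : μ < 0 := hμ0.lt_of_ne fun h =>
    hne (by rw [h, neg_zero, zero_div, Complex.ofReal_zero])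
  refine ⟨hneg, ?_⟩
  convert tendsto_radial_div hs hdinv hposinv hlim one_ne_zero hone using 2
  rw [← Complex.ofReal_one, ← Complex.ofReal_div]
  have := norm_ne_zero_iff.2 (sub_ne_zero.2 hτs)
  have := hneg.ne
  field_simp

theorem p0_eq (τ : ℂ) (σ : Fin n → ℂ) (Λ : Fin n → ℝ) (z : ℂ) :
    p0 τ σ Λ z = ∑ k, (alpha τ σ Λ k : ℂ) * herglotz (σ k) z := rfl

/-- The limits of `(1 - r) / p (r * σ k)` bound the atoms of the Herglotz measure of `1 / p`
at the points `σ k` from below. -/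
theorem p0_re_le_inv_berksonPorta_re (hσ : ∀ k, ‖σ k‖ = 1) (hinj : Function.Injective σ)
    (hτ : ‖τ‖ = 1) (hτσ : ∀ k, τ ≠ σ k) (hG : G ∈ Gen τ σ Λ)
    (hpos : ∀ z ∈ disk, 0 < (berksonPorta τ G z).re) {z : ℂ} (hz : z ∈ disk) :
    (p0 τ σ Λ z).re ≤ ((berksonPorta τ G z)⁻¹).re := by
  have hd := differentiableOn_berksonPorta hτ (differentiableOn_of_mem_gen hG)
  obtain ⟨φ, -, -, -, hk⟩ := hG
  choose μ hμΛ hμ0 hμ using hk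
  have hatom := fun k => spectralValue_neg_and_tendsto_radial_inv_berksonPorta (hσ k) (hτσ k) hd
    hpos (hμ0 k) (hμ k).2
  have hsum := sum_mul_re_herglotz_le_of_radial (q := fun z => (berksonPorta τ G z)⁻¹) hσ hinj
    (hd.inv fun z hz => ne_zero_of_re_pos (hpos z hz))
    (fun z hz => (inv_re_pos (hpos z hz)).le) (fun k => (hatom k).2) Finset.univ z hz
  rw [p0_eq]
  simp only [Complex.sub_re, Complex.re_sum, Complex.re_ofReal_mul] at hsum ⊢
  refine (Finset.sum_le_sum fun k _ => ?_).trans (sub_nonneg.1 hsum)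
  have hneg := (hatom k).1
  have hherglotz := (herglotz_re_pos (hσ k) hz).le
  rw [alpha, abs_of_neg ((hμΛ k).trans_lt hneg)]
  gcongr
  · linarith
  · exact hμΛ k

end Generators


/-! ### The semigroup generated by a function of Berkson–Porta type -/

/-- The inverse of `herglotz τ`, from the right half-plane onto the disk. -/
def cayleyInv (τ u : ℂ) : ℂ := τ * ((u - 1) / (u + 1))

theorem add_one_ne_zero_of_re_pos {u : ℂ} (hu : 0 < u.re) : u + 1 ≠ 0 :=
  ne_zero_of_re_pos (by rw [Complex.add_re, Complex.one_re]; positivity)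

theorem cayleyInv_mem_disk {τ u : ℂ} (hτ : ‖τ‖ = 1) (hu : 0 < u.re) : cayleyInv τ u ∈ disk := by
  have hden := norm_pos_iff.2 (add_one_ne_zero_of_re_pos hu)
  have hgap := norm_sq_add_conj_sub_norm_sq_sub u 1
  rw [map_one, Complex.one_re] at hgap
  rw [mem_disk, cayleyInv, norm_mul, hτ, one_mul, norm_div, div_lt_one hden]
  exact lt_of_pow_lt_pow_left₀ 2 hden.le (by linarith)

theorem cayleyInv_herglotz {τ z : ℂ} (hτ : ‖τ‖ = 1) (hz : z ∈ disk) :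
    cayleyInv τ (herglotz τ z) = z := by
  have hsub := sub_ne_zero_of_mem_disk hτ hz
  have := ne_zero_of_norm_one hτ
  rw [cayleyInv, ← mul_div_assoc,
    div_eq_iff (add_one_ne_zero_of_re_pos (herglotz_re_pos hτ hz)), herglotz]
  field_simp
  ring

theorem hasDerivAt_cayleyInv {τ u : ℂ} (hu : u + 1 ≠ 0) :
    HasDerivAt (cayleyInv τ) (2 * τ / (u + 1) ^ 2) u := by
  have h := (((hasDerivAt_id u).sub_const 1).div ((hasDerivAt_id u).add_const 1) hu).const_mul τ
  refine h.congr_deriv ?_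
  simp only [id_eq]
  field_simp
  ring

theorem mul_berksonPorta_cayleyInv {G : ℂ → ℂ} {τ u : ℂ} (hτ : ‖τ‖ = 1) (hu : 0 < u.re) :
    4 * τ / (u + 1) ^ 2 * berksonPorta τ G (cayleyInv τ u) = G (cayleyInv τ u) := by
  have hu1 := add_one_ne_zero_of_re_pos hu
  have hfactor : 4 * τ / (u + 1) ^ 2 = (τ - cayleyInv τ u) * (1 - conj τ * cayleyInv τ u) := by
    rw [one_sub_conj_mul_eq hτ, cayleyInv]
    field_simp
    linear_combination -4 * τ * conj_mul_self_of_norm_one hτ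
  rw [hfactor, berksonPorta, mul_div_cancel₀ _ (porta_factor_ne_zero hτ (cayleyInv_mem_disk hτ hu))]

/-- The Noshiro–Warschawski criterion: the real part of `(f b - f a) / (b - a)` is an average of
the real part of `f'` over the segment from `a` to `b`. -/
theorem injOn_of_re_deriv_pos {f f' : ℂ → ℂ} {s : Set ℂ} (hs : Convex ℝ s)
    (hf : ∀ z ∈ s, HasDerivAt f (f' z) z) (hpos : ∀ z ∈ s, 0 < (f' z).re) : InjOn f s := by
  intro a ha b hb heq
  by_contra hne
  have hba : b - a ≠ 0 := sub_ne_zero.2 (Ne.symm hne)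
  have hmem : ∀ t ∈ Icc (0 : ℝ) 1, a + t * (b - a) ∈ s := fun t ht => by
    simpa using hs.add_smul_sub_mem ha hb ht
  have hderiv : ∀ t ∈ Icc (0 : ℝ) 1, HasDerivAt (fun t : ℝ => (f (a + t * (b - a)) / (b - a)).re)
      (f' (a + t * (b - a))).re t := by
    intro t ht
    have hline : HasDerivAt (fun w : ℂ => a + w * (b - a)) (b - a) (t : ℂ) := by
      simpa using ((hasDerivAt_id (t : ℂ)).mul_const (b - a)).const_add a
    have h := (((hf _ (hmem t ht)).comp (t : ℂ) hline).div_const (b - a)).real_of_complex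
    rwa [mul_div_cancel_right₀ _ hba] at h
  have hmono := strictMonoOn_of_hasDerivWithinAt_pos (convex_Icc (0 : ℝ) 1)
    (fun t ht => (hderiv t ht).continuousAt.continuousWithinAt)
    (fun t ht => (hderiv t (interior_subset ht)).hasDerivWithinAt)
    fun t ht => hpos _ (hmem t (interior_subset ht))
  have hlt := hmono (left_mem_Icc.2 zero_le_one) (right_mem_Icc.2 zero_le_one) zero_lt_one
  simp [heq] at hlt

theorem antitoneOn_norm_sq_div_sq {E : Type*} [NormedAddCommGroup E] [InnerProductSpace ℝ E]
    {w w' : ℝ → E} {x x' : ℝ → ℝ} {s : Set ℝ} (hs : Convex ℝ s)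
    (hw : ∀ t ∈ s, HasDerivWithinAt w (w' t) s t) (hx : ∀ t ∈ s, HasDerivWithinAt x (x' t) s t)
    (hpos : ∀ t ∈ s, 0 < x t) (hle : ∀ t ∈ s, ‖w' t‖ * x t ≤ x' t * ‖w t‖) :
    AntitoneOn (fun t => ‖w t‖ ^ 2 / x t ^ 2) s := by
  have hderiv : ∀ t ∈ s, _ := fun t ht =>
    (hw t ht).norm_sq.div ((hx t ht).pow 2) (pow_pos (hpos t ht) 2).ne'
  refine antitoneOn_of_hasDerivWithinAt_nonpos hs (fun t ht => (hderiv t ht).continuousWithinAt)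
    (fun t ht => (hderiv t (interior_subset ht)).mono interior_subset) fun t ht => ?_
  have hxt := hpos t (interior_subset ht)
  have hinner : inner ℝ (w t) (w' t) * x t ≤ x' t * ‖w t‖ ^ 2 :=
    calc inner ℝ (w t) (w' t) * x t ≤ ‖w t‖ * ‖w' t‖ * x t := by
          gcongr
          exact real_inner_le_norm _ _
      _ = ‖w t‖ * (‖w' t‖ * x t) := mul_assoc _ _ _
      _ ≤ ‖w t‖ * (x' t * ‖w t‖) :=
          mul_le_mul_of_nonneg_left (hle t (interior_subset ht)) (norm_nonneg _)
      _ = x' t * ‖w t‖ ^ 2 := by ring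
  refine div_nonpos_of_nonpos_of_nonneg ?_ (by positivity)
  simp only [Pi.pow_apply, Nat.cast_ofNat, Nat.add_one_sub_one, pow_one]
  linarith [mul_le_mul_of_nonneg_left hinner hxt.le]

section Flow

variable {G : ℂ → ℂ} {τ : ℂ}

theorem norm_deriv_berksonPorta_mul_le (hτ : ‖τ‖ = 1) (hG : DifferentiableOn ℂ G disk)
    (hpos : ∀ z ∈ disk, 0 ≤ (berksonPorta τ G z).re) {z : ℂ} (hz : z ∈ disk) :
    ‖deriv (berksonPorta τ G) z * G z‖ * (herglotz τ z).re ≤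
      2 * (berksonPorta τ G z).re * ‖berksonPorta τ G z‖ := by
  have hsub := norm_pos_iff.2 (sub_ne_zero_of_mem_disk hτ hz)
  have hnorm : ‖G z‖ = ‖τ - z‖ ^ 2 * ‖berksonPorta τ G z‖ := by
    rw [berksonPorta, one_sub_conj_mul_eq hτ, norm_div, norm_mul, norm_mul, RCLike.norm_conj, hτ]
    field_simp
  have hpick := mul_norm_deriv_le (differentiableOn_berksonPorta hτ hG) hpos hz
  calc _ = (1 - ‖z‖ ^ 2) * ‖deriv (berksonPorta τ G) z‖ * ‖berksonPorta τ G z‖ := by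
        rw [norm_mul, hnorm, herglotz_re hτ]
        field_simp
    _ ≤ _ := by gcongr

variable {v : ℝ → ℂ} {T : ℝ}

/-- By Schwarz–Pick, `‖p (v t)‖ / Re (herglotz τ (v t))` is nonincreasing along the flow, so in the
half-plane the flow has at most linear speed. -/
theorem exists_norm_berksonPorta_le_of_flow (hτ : ‖τ‖ = 1) (hG : DifferentiableOn ℂ G disk)
    (hpos : ∀ z ∈ disk, 0 ≤ (berksonPorta τ G z).re) (hT : 0 < T)
    (hv : ∀ t ∈ Ico 0 T, v t ∈ disk) (hd : ∀ t ∈ Ico 0 T, HasDerivAt v (G (v t)) t) :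
    ∃ C : ℝ, ∀ t ∈ Ico 0 T, ‖berksonPorta τ G (v t)‖ ≤ C * ‖herglotz τ (v t)‖ := by
  have hanti := antitoneOn_norm_sq_div_sq (convex_Ico 0 T)
    (w := fun t => berksonPorta τ G (v t)) (x := fun t => (herglotz τ (v t)).re)
    (fun t ht => ((differentiableOn_berksonPorta hτ hG).differentiableAt
      (isOpen_disk.mem_nhds (hv t ht))).hasDerivAt.comp_hasDerivWithinAt t
        (hd t ht).hasDerivWithinAt)
    (fun t ht => hasDerivWithinAt_re (hasDerivWithinAt_herglotz_comp hτ (hv t ht)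
      (hd t ht).hasDerivWithinAt))
    (fun t ht => herglotz_re_pos hτ (hv t ht)) fun t ht => by
      rw [← Complex.ofReal_ofNat, Complex.re_ofReal_mul]
      exact norm_deriv_berksonPorta_mul_le hτ hG hpos (hv t ht)
  have hre := fun t ht => herglotz_re_pos hτ (hv t ht)
  have h0 : (0 : ℝ) ∈ Ico 0 T := left_mem_Ico.2 hT
  refine ⟨‖berksonPorta τ G (v 0)‖ / (herglotz τ (v 0)).re, fun t ht => ?_⟩
  have hle := hanti h0 ht ht.1
  simp only [← div_pow] at hle
  have hC : 0 ≤ ‖berksonPorta τ G (v 0)‖ / (herglotz τ (v 0)).re :=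
    div_nonneg (norm_nonneg _) (hre 0 h0).le
  have hquot := (div_le_iff₀ (hre t ht)).1 (le_of_sq_le_sq hle hC)
  exact hquot.trans (mul_le_mul_of_nonneg_left (Complex.re_le_norm _) hC)

theorem exists_norm_herglotz_le_of_flow (hτ : ‖τ‖ = 1) (hG : DifferentiableOn ℂ G disk)
    (hpos : ∀ z ∈ disk, 0 ≤ (berksonPorta τ G z).re) (hT : 0 < T)
    (hv : ∀ t ∈ Ico 0 T, v t ∈ disk) (hd : ∀ t ∈ Ico 0 T, HasDerivAt v (G (v t)) t) :
    ∃ R : ℝ, ∀ t ∈ Ico 0 T, ‖herglotz τ (v t)‖ ≤ R := by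
  obtain ⟨C, hC⟩ := exists_norm_berksonPorta_le_of_flow hτ hG hpos hT hv hd
  refine ⟨‖herglotz τ (v 0)‖ * Real.exp (|2 * C| * T), fun t ht => ?_⟩
  have hsub : ∀ x ∈ Icc 0 t, x ∈ Ico 0 T := fun x hx => ⟨hx.1, hx.2.trans_lt ht.2⟩
  have hderiv : ∀ x ∈ Icc 0 t, ∀ s : Set ℝ, HasDerivWithinAt (fun t => herglotz τ (v t))
      (2 * berksonPorta τ G (v x)) s x := fun x hx _ =>
    hasDerivWithinAt_herglotz_comp hτ (hv x (hsub x hx)) (hd x (hsub x hx)).hasDerivWithinAt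
  have hgronwall := norm_le_gronwallBound_of_norm_deriv_right_le (K := 2 * C) (ε := 0)
    (fun x hx => (hderiv x hx _).continuousWithinAt)
    (fun x hx => hderiv x (Ico_subset_Icc_self hx) _) le_rfl
    (fun x hx => by
      rw [norm_mul, Complex.norm_ofNat, add_zero, mul_assoc]
      have := hC x (hsub x (Ico_subset_Icc_self hx))
      gcongr) t (right_mem_Icc.2 ht.1)
  rw [gronwallBound_ε0, sub_zero] at hgronwall
  refine hgronwall.trans ?_
  have := ht.1
  gcongr
  · exact le_abs_self _
  · exact ht.2.le

theorem exists_isCompact_of_flow (hτ : ‖τ‖ = 1) (hG : DifferentiableOn ℂ G disk)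
    (hpos : ∀ z ∈ disk, 0 ≤ (berksonPorta τ G z).re) (hT : 0 < T)
    (hv : ∀ t ∈ Ico 0 T, v t ∈ disk) (hd : ∀ t ∈ Ico 0 T, HasDerivAt v (G (v t)) t) :
    ∃ K ⊆ disk, IsCompact K ∧ ∀ t ∈ Ico 0 T, v t ∈ K := by
  obtain ⟨R, hR⟩ := exists_norm_herglotz_le_of_flow hτ hG hpos hT hv hd
  have h0 : (0 : ℝ) ∈ Ico 0 T := left_mem_Ico.2 hT
  have hmono := monotoneOn_exp_mul_re_herglotz (m := 0) hτ (convex_Ico 0 T) hv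
    (fun t ht => (hd t ht).hasDerivWithinAt) fun z hz => by
      have := hpos z hz
      rw [zero_mul]
      positivity
  set a := (herglotz τ (v 0)).re
  have ha : 0 < a := herglotz_re_pos hτ (hv 0 h0)
  set L : Set ℂ := Metric.closedBall 0 R ∩ {u | a ≤ u.re}
  have hL : IsCompact L :=
    (isCompact_closedBall 0 R).inter_right (isClosed_le continuous_const Complex.continuous_re)
  refine ⟨cayleyInv τ '' L, ?_, hL.image_of_continuousOn fun u hu => ?_, fun t ht => ?_⟩
  · rintro _ ⟨u, hu, rfl⟩
    exact cayleyInv_mem_disk hτ (ha.trans_le hu.2)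
  · exact (hasDerivAt_cayleyInv
      (add_one_ne_zero_of_re_pos (ha.trans_le hu.2))).continuousAt.continuousWithinAt
  · refine ⟨herglotz τ (v t), ⟨mem_closedBall_zero_iff.2 (hR t ht), ?_⟩,
      cayleyInv_herglotz hτ (hv t ht)⟩
    simpa using hmono h0 ht ht.1

theorem injOn_of_hasDerivAt_inv_generator {H : ℂ → ℂ} (hτ : ‖τ‖ = 1)
    (hpos : ∀ z ∈ disk, 0 < (berksonPorta τ G z).re)
    (hH : ∀ z ∈ disk, HasDerivAt H (G z)⁻¹ z) : InjOn H disk := by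
  have hinj : InjOn (H ∘ cayleyInv τ) {u | 0 < u.re} := by
    refine injOn_of_re_deriv_pos (f' := fun u => (2 * berksonPorta τ G (cayleyInv τ u))⁻¹)
      (convex_halfSpace_re_gt 0) (fun u hu => ?_) fun u hu => ?_
    · have hu1 := add_one_ne_zero_of_re_pos hu
      have hmem := cayleyInv_mem_disk hτ hu
      refine ((hH _ hmem).comp u (hasDerivAt_cayleyInv hu1)).congr_deriv ?_
      have hp := ne_zero_of_re_pos (hpos _ hmem)
      have hτ0 := ne_zero_of_norm_one hτ
      rw [← mul_berksonPorta_cayleyInv (G := G) hτ hu]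
      field_simp
      norm_num
    · have := hpos _ (cayleyInv_mem_disk hτ hu)
      refine inv_re_pos ?_
      rw [← Complex.ofReal_ofNat, Complex.re_ofReal_mul]
      positivity
  intro z₁ h₁ z₂ h₂ heq
  rw [← cayleyInv_herglotz hτ h₁, ← cayleyInv_herglotz hτ h₂]
  refine congrArg _ (hinj (herglotz_re_pos hτ h₁) (herglotz_re_pos hτ h₂) ?_)
  simp only [Function.comp_apply, cayleyInv_herglotz hτ h₁, cayleyInv_herglotz hτ h₂, heq]

theorem generator_ne_zero (hpos : ∀ z ∈ disk, 0 < (berksonPorta τ G z).re) :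
    ∀ z ∈ disk, G z ≠ 0 := fun z hz h0 => by
  have := hpos z hz
  simp [berksonPorta, h0] at this

/-- The Koenigs function of a generator, which conjugates the semigroup to `w ↦ w + t`. -/
theorem exists_koenigs (hτ : ‖τ‖ = 1) (hG : DifferentiableOn ℂ G disk)
    (hpos : ∀ z ∈ disk, 0 < (berksonPorta τ G z).re) :
    ∃ e : OpenPartialHomeomorph ℂ ℂ, e.source = disk ∧ ∀ z ∈ disk, HasDerivAt e (G z)⁻¹ z := by
  obtain ⟨H, hH⟩ : ∃ H : ℂ → ℂ, ∀ z ∈ disk, HasDerivAt H (G z)⁻¹ z :=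
    DifferentiableOn.isExactOn_ball (hG.inv (generator_ne_zero hpos))
  have hHd : DifferentiableOn ℂ H disk := fun z hz =>
    (hH z hz).differentiableAt.differentiableWithinAt
  have hinj := injOn_of_hasDerivAt_inv_generator hτ hpos hH
  have hopen : ∀ s ⊆ disk, IsOpen s → IsOpen (H '' s) := by
    refine ((hHd.analyticOnNhd isOpen_disk).is_constant_or_isOpen
      convex_disk.isPreconnected).resolve_left ?_
    rintro ⟨w, hw⟩
    have hhalf : (1 / 2 : ℂ) ∈ disk := by rw [mem_disk]; norm_num
    have := hinj hhalf zero_mem_disk ((hw _ hhalf).trans (hw _ zero_mem_disk).symm)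
    norm_num at this
  refine ⟨.ofContinuousOpenRestrict (hinj.toPartialEquiv H disk) hHd.continuousOn (fun U hU => ?_)
    isOpen_disk, rfl, hH⟩
  have himage := hopen _ (Subtype.coe_image_subset disk U) (isOpen_disk.isOpenMap_subtype_val U hU)
  exact (image_comp H Subtype.val U).symm ▸ himage

theorem hasDerivAt_koenigs_flow {e : OpenPartialHomeomorph ℂ ℂ} (hsource : e.source = disk)
    (he : ∀ z ∈ disk, HasDerivAt e (G z)⁻¹ z) (hG0 : ∀ z ∈ disk, G z ≠ 0) {w : ℂ} {t : ℝ}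
    (ht : w + t ∈ e.target) :
    HasDerivAt (fun t : ℝ => e.symm (w + t)) (G (e.symm (w + t))) t := by
  have hmem : e.symm (w + t) ∈ disk := hsource ▸ e.map_target ht
  have hsymm := e.hasDerivAt_symm ht (inv_ne_zero (hG0 _ hmem)) (he _ hmem)
  have hline : HasDerivAt (fun t : ℂ => w + t) 1 (t : ℂ) := (hasDerivAt_id _).const_add _
  simpa using (hsymm.comp (t : ℂ) hline).comp_ofReal

theorem add_mem_koenigs_target {e : OpenPartialHomeomorph ℂ ℂ} (hτ : ‖τ‖ = 1)
    (hG : DifferentiableOn ℂ G disk) (hpos : ∀ z ∈ disk, 0 < (berksonPorta τ G z).re)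
    (hsource : e.source = disk)
    (hflow : ∀ {w : ℂ} {t : ℝ}, w + t ∈ e.target →
      HasDerivAt (fun t : ℝ => e.symm (w + t)) (G (e.symm (w + t))) t)
    {w : ℂ} (hw : w ∈ e.target) {t : ℝ} (ht : 0 ≤ t) : w + t ∈ e.target := by
  by_contra hcon
  set B : Set ℝ := Ici 0 ∩ {t | w + t ∉ e.target}
  have hline : Continuous fun t : ℝ => w + (t : ℂ) := by fun_prop
  have hclosed : IsClosed B :=
    isClosed_Ici.inter (e.open_target.preimage hline).isClosed_compl
  have hbdd : BddBelow B := ⟨0, fun t ht => ht.1⟩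
  have hT : sInf B ∈ B := hclosed.csInf_mem ⟨t, ht, hcon⟩ hbdd
  set T := sInf B
  have hbefore : ∀ s ∈ Ico 0 T, w + s ∈ e.target := fun s hs => by
    by_contra hsB
    exact (csInf_le hbdd (show s ∈ B from ⟨hs.1, hsB⟩)).not_gt hs.2
  have hT0 : 0 < T := hT.1.lt_of_ne fun h0 => hT.2 (by rwa [← h0, Complex.ofReal_zero, add_zero])
  obtain ⟨K, hKdisk, hK, hmem⟩ := exists_isCompact_of_flow hτ hG (fun z hz => (hpos z hz).le) hT0
    (fun s hs => hsource ▸ e.map_target (hbefore s hs)) fun s hs => hflow (hbefore s hs)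
  have himage : IsClosed (e '' K) :=
    (hK.image_of_continuousOn (e.continuousOn.mono (hsource ▸ hKdisk))).isClosed
  have hlim : w + T ∈ e '' K := by
    have htend : Tendsto (fun s : ℝ => w + (s : ℂ)) (𝓝[<] T) (𝓝 (w + T)) :=
      (hline.tendsto T).mono_left nhdsWithin_le_nhds
    refine himage.mem_of_tendsto htend ?_
    filter_upwards [Ioo_mem_nhdsLT hT0] with s hs
    exact ⟨_, hmem s (Ioo_subset_Ico_self hs), e.right_inv (hbefore s (Ioo_subset_Ico_self hs))⟩
  obtain ⟨y, hy, hyT⟩ := hlim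
  exact hT.2 (hyT ▸ e.map_source (hsource ▸ hKdisk hy))

theorem exists_semigroup (hτ : ‖τ‖ = 1) (hG : DifferentiableOn ℂ G disk)
    (hpos : ∀ z ∈ disk, 0 < (berksonPorta τ G z).re) :
    ∃ φ : ℝ → ℂ → ℂ, IsOneParamSemigroup φ ∧ IsGeneratorOf G φ ∧
      ∀ t : ℝ, 0 < t → ∀ z ∈ disk, φ t z ≠ z := by
  obtain ⟨e, hsource, he⟩ := exists_koenigs hτ hG hpos
  have hG0 := generator_ne_zero hpos
  have hflow : ∀ {w : ℂ} {t : ℝ}, w + t ∈ e.target → _ :=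
    fun ht => hasDerivAt_koenigs_flow hsource he hG0 ht
  have htarget : ∀ z ∈ disk, e z ∈ e.target := fun z hz => e.map_source (hsource ▸ hz)
  have hadd : ∀ z ∈ disk, ∀ t : ℝ, 0 ≤ t → e z + t ∈ e.target := fun z hz t ht =>
    add_mem_koenigs_target hτ hG hpos hsource hflow (htarget z hz) ht
  have hleft : ∀ z ∈ disk, e.symm (e z) = z := fun z hz => e.left_inv (hsource ▸ hz)
  have hmem : ∀ w ∈ e.target, e.symm w ∈ disk := fun w hw => hsource ▸ e.map_target hw
  refine ⟨fun t z => e.symm (e z + t),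
    ⟨fun t ht z hz => ?_, fun t ht z hz => hmem _ (hadd z hz t ht),
      fun z hz => ?_, fun s t _ ht z hz => ?_, fun z hz => ?_⟩,
    ⟨hG, fun z hz t ht => (hflow (hadd z hz t ht)).hasDerivWithinAt⟩, fun t ht z hz hfix => ?_⟩
  · have hmem' := hmem _ (hadd z hz t ht)
    have hsymm := e.hasDerivAt_symm (hadd z hz t ht) (inv_ne_zero (hG0 _ hmem')) (he _ hmem')
    exact (hsymm.comp z ((he z hz).add_const _)).differentiableAt.differentiableWithinAt
  · simp only [Complex.ofReal_zero, add_zero, hleft z hz]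
  · rw [e.right_inv (hadd z hz t ht), Complex.ofReal_add, add_right_comm, add_assoc]
  · have hcont := (hflow (hadd z hz 0 le_rfl)).continuousAt.tendsto
    simp only [Complex.ofReal_zero, add_zero, hleft z hz] at hcont
    exact hcont.mono_left nhdsWithin_le_nhds
  · have hright := e.right_inv (hadd z hz t ht.le)
    rw [show e.symm (e z + t) = z from hfix] at hright
    exact ht.ne' (Complex.ofReal_eq_zero.1 (left_eq_add.1 hright))

end Flow


/-! ### Regular boundary fixed points of the generated semigroup -/

section LinearPerturbation

variable {E : Type*} [NormedAddCommGroup E] [NormedSpace ℝ E] {f f' : ℝ → E} {μ ε t : ℝ}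

theorem norm_exp_smul_sub_le (hε : 0 < ε) (ht : 0 ≤ t)
    (hf : ∀ x ∈ Icc 0 t, HasDerivWithinAt f (f' x) (Ici 0) x)
    (hle : ∀ x ∈ Ico 0 t, ‖f' x + μ • f x‖ ≤ ε * ‖f x‖) :
    ‖Real.exp (μ * t) • f t - f 0‖ ≤ ‖f 0‖ * (Real.exp (ε * t) - 1) := by
  have hderiv : ∀ x ∈ Icc 0 t, HasDerivWithinAt (fun x => Real.exp (μ * x) • f x - f 0)
      (Real.exp (μ * x) • (f' x + μ • f x)) (Ici 0) x := fun x hx => by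
    have hexp := (((hasDerivAt_id x).const_mul μ).exp).hasDerivWithinAt (s := Ici 0)
    refine ((hexp.smul (hf x hx)).sub_const (f 0)).congr_deriv ?_
    simp only [id_eq, mul_one, smul_add, smul_smul]
  have hgronwall := norm_le_gronwallBound_of_norm_deriv_right_le (δ := 0) (K := ε)
    (ε := ε * ‖f 0‖)
    (fun x hx => ((hderiv x hx).mono Icc_subset_Ici_self).continuousWithinAt)
    (fun x hx => (hderiv x (Ico_subset_Icc_self hx)).mono (Ici_subset_Ici.2 hx.1)) (by simp)
    (fun x hx => ?_) t (right_mem_Icc.2 ht)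
  · simpa [gronwallBound_of_K_ne_0 hε.ne', mul_div_cancel_left₀ _ hε.ne'] using hgronwall
  · rw [norm_smul, ← mul_add]
    calc ‖Real.exp (μ * x)‖ * ‖f' x + μ • f x‖ ≤ ‖Real.exp (μ * x)‖ * (ε * ‖f x‖) := by
          gcongr
          exact hle x hx
      _ = ε * ‖Real.exp (μ * x) • f x‖ := by rw [norm_smul]; ring
      _ ≤ ε * (‖Real.exp (μ * x) • f x - f 0‖ + ‖f 0‖) := by
          gcongr
          exact norm_le_norm_sub_add _ _

theorem norm_le_mul_exp_of_local {δ : ℝ} (hε : 0 ≤ ε)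
    (hf : ∀ x ∈ Icc 0 t, HasDerivWithinAt f (f' x) (Ici 0) x)
    (hle : ∀ x ∈ Ico 0 t, ‖f x‖ < δ → ‖f' x + μ • f x‖ ≤ ε * ‖f x‖) (h0 : f 0 ≠ 0)
    (hδ : ‖f 0‖ * Real.exp ((|μ| + ε + 1) * t) < δ) :
    ∀ x ∈ Icc 0 t, ‖f x‖ ≤ ‖f 0‖ * Real.exp ((|μ| + ε + 1) * x) := by
  set K := |μ| + ε + 1
  have : 0 ≤ K := by positivity
  refine image_norm_le_of_norm_deriv_right_lt_deriv_boundary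
    (B' := fun x => K * (‖f 0‖ * Real.exp (K * x)))
    (fun x hx => ((hf x hx).mono Icc_subset_Ici_self).continuousWithinAt)
    (fun x hx => (hf x (Ico_subset_Icc_self hx)).mono (Ici_subset_Ici.2 hx.1)) (by simp)
    (fun x => ?_) fun x hx heq => ?_
  · refine ((((hasDerivAt_id x).const_mul K).exp).const_mul ‖f 0‖).congr_deriv ?_
    simp only [id_eq]
    ring
  · have hpos : 0 < ‖f x‖ := by
      rw [heq]
      positivity
    have hlt : ‖f x‖ < δ := by
      rw [heq]
      refine lt_of_le_of_lt ?_ hδ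
      gcongr
      exact hx.2.le
    rw [← heq]
    calc ‖f' x‖ = ‖(f' x + μ • f x) - μ • f x‖ := by rw [add_sub_cancel_right]
      _ ≤ ‖f' x + μ • f x‖ + ‖μ • f x‖ := norm_sub_le _ _
      _ ≤ ε * ‖f x‖ + |μ| * ‖f x‖ := by
          rw [norm_smul, Real.norm_eq_abs]
          gcongr
          exact hle x hx hlt
      _ < K * ‖f x‖ := by
          rw [← add_mul]
          gcongr
          linarith

end LinearPerturbation

section BoundaryFixedPoint

variable {G : ℂ → ℂ} {σ : ℂ} {μ : ℝ}

theorem exists_norm_add_smul_le (hσ : ‖σ‖ = 1)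
    (hlim : Tendsto (fun z => G z / (σ - z)) (𝓝[disk] σ) (𝓝 μ)) {ε : ℝ} (hε : 0 < ε) :
    ∃ δ > 0, ∀ w ∈ disk, ‖w - σ‖ < δ → ‖G w + μ • (w - σ)‖ ≤ ε * ‖w - σ‖ := by
  obtain ⟨δ, hδ, hclose⟩ := Metric.eventually_nhds_iff.1 (eventually_nhdsWithin_iff.1
    (Metric.tendsto_nhds.1 hlim ε hε))
  refine ⟨δ, hδ, fun w hw hwδ => ?_⟩
  have hlt := hclose (by rwa [dist_eq_norm]) hw
  rw [dist_eq_norm] at hlt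
  have hfactor : G w + μ • (w - σ) = (G w / (σ - w) - μ) * (σ - w) := by
    rw [sub_mul, div_mul_cancel₀ _ (sub_ne_zero_of_mem_disk hσ hw), Complex.real_smul]
    ring
  rw [hfactor, norm_mul, norm_sub_rev σ w]
  gcongr

variable {φ : ℝ → ℂ → ℂ} {t : ℝ}

theorem eventually_norm_exp_smul_flow_sub_le (hσ : ‖σ‖ = 1) (hφ : IsOneParamSemigroup φ)
    (hgen : IsGeneratorOf G φ) (hlim : Tendsto (fun z => G z / (σ - z)) (𝓝[disk] σ) (𝓝 μ))
    (ht : 0 ≤ t) {ε : ℝ} (hε : 0 < ε) :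
    ∀ᶠ z in 𝓝[disk] σ, ‖Real.exp (μ * t) • (φ t z - σ) - (z - σ)‖ ≤
      ‖z - σ‖ * (Real.exp (ε * t) - 1) := by
  obtain ⟨δ, hδ, hlinear⟩ := exists_norm_add_smul_le hσ hlim hε
  have hsmall : ∀ᶠ z in 𝓝[disk] σ, ‖z - σ‖ * Real.exp ((|μ| + ε + 1) * t) < δ := by
    have hcont : Continuous fun z : ℂ => ‖z - σ‖ * Real.exp ((|μ| + ε + 1) * t) := by fun_prop
    refine eventually_nhdsWithin_of_eventually_nhds
      (hcont.continuousAt.eventually_lt continuousAt_const ?_)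
    simpa using hδ
  filter_upwards [hsmall, self_mem_nhdsWithin] with z hz hzd
  have hderiv : ∀ x ∈ Icc 0 t, HasDerivWithinAt (fun s => φ s z - σ) (G (φ x z)) (Ici 0) x :=
    fun x hx => (hgen.2 z hzd x hx.1).sub_const σ
  have h0 : φ 0 z - σ = z - σ := by rw [hφ.zero z hzd]
  have hconfined := norm_le_mul_exp_of_local (δ := δ) hε.le hderiv
    (fun x hx hxδ => hlinear _ (hφ.mapsTo x hx.1 hzd) hxδ)
    (by rw [h0, ← neg_ne_zero, neg_sub]; exact sub_ne_zero_of_mem_disk hσ hzd) (by rwa [h0])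
  have hle := norm_exp_smul_sub_le (μ := μ) hε ht hderiv fun x hx =>
    hlinear _ (hφ.mapsTo x hx.1 hzd) <| (hconfined x (Ico_subset_Icc_self hx)).trans_lt <| by
      rw [h0]
      refine lt_of_le_of_lt ?_ hz
      gcongr
      exact hx.2.le
  simpa only [h0] using hle

theorem tendsto_flow_div (hσ : ‖σ‖ = 1) (hφ : IsOneParamSemigroup φ)
    (hgen : IsGeneratorOf G φ) (hlim : Tendsto (fun z => G z / (σ - z)) (𝓝[disk] σ) (𝓝 μ))
    (ht : 0 ≤ t) : Tendsto (fun z => (φ t z - σ) / (z - σ)) (𝓝[disk] σ)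
      (𝓝 ((Real.exp (-(μ * t)) : ℝ) : ℂ)) := by
  rw [Metric.tendsto_nhds]
  intro η hη
  obtain ⟨ε, hεη, hε⟩ : ∃ ε : ℝ, Real.exp (-(μ * t)) * (Real.exp (ε * t) - 1) < η ∧ 0 < ε := by
    have hcont : Continuous fun ε : ℝ => Real.exp (-(μ * t)) * (Real.exp (ε * t) - 1) := by
      fun_prop
    have hev := (hcont.continuousAt (x := 0)).eventually_lt continuousAt_const (by simpa using hη)
    exact ((eventually_nhdsWithin_of_eventually_nhds hev).and self_mem_nhdsWithin).exists
      (f := 𝓝[>] 0)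
  filter_upwards [eventually_norm_exp_smul_flow_sub_le hσ hφ hgen hlim ht hε,
    self_mem_nhdsWithin] with z hz hzd
  have hne : z - σ ≠ 0 := sub_ne_zero.2 (sub_ne_zero.1 (sub_ne_zero_of_mem_disk hσ hzd)).symm
  have hexp : Real.exp (-(μ * t)) * Real.exp (μ * t) = 1 := by
    rw [← Real.exp_add, neg_add_cancel, Real.exp_zero]
  have hdiff : (φ t z - σ) / (z - σ) - ((Real.exp (-(μ * t)) : ℝ) : ℂ) =
      Real.exp (-(μ * t)) • (Real.exp (μ * t) • (φ t z - σ) - (z - σ)) / (z - σ) := by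
    rw [smul_sub, smul_smul, hexp, one_smul, Complex.real_smul, div_sub' hne, mul_comm (z - σ)]
  rw [dist_eq_norm, hdiff, norm_div, norm_smul, Real.norm_of_nonneg (Real.exp_pos _).le,
    div_lt_iff₀ (norm_pos_iff.2 hne)]
  calc _ ≤ Real.exp (-(μ * t)) * (‖z - σ‖ * (Real.exp (ε * t) - 1)) := by gcongr
    _ = Real.exp (-(μ * t)) * (Real.exp (ε * t) - 1) * ‖z - σ‖ := by ring
    _ < η * ‖z - σ‖ := by
        have := norm_pos_iff.2 hne
        gcongr

theorem flow_hasAngularDerivAtFixed (hσ : ‖σ‖ = 1) (hφ : IsOneParamSemigroup φ)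
    (hgen : IsGeneratorOf G φ) (hlim : Tendsto (fun z => G z / (σ - z)) (𝓝[disk] σ) (𝓝 μ))
    (ht : 0 ≤ t) : HasAngularDerivAtFixed (φ t) σ ((Real.exp (-(μ * t)) : ℝ) : ℂ) := by
  have hquot := tendsto_flow_div hσ hφ hgen hlim ht
  refine ⟨hσ, hasAngularLimit_of_tendsto_disk ?_, hasAngularLimit_of_tendsto_disk hquot⟩
  have hid : Tendsto (fun z : ℂ => z) (𝓝[disk] σ) (𝓝 σ) := nhdsWithin_le_nhds
  have hprod := (hquot.mul (hid.sub_const σ)).add_const σ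
  rw [sub_self, mul_zero, zero_add] at hprod
  refine hprod.congr' (eventually_mem_nhdsWithin.mono fun z hz => ?_)
  rw [div_mul_cancel₀, sub_add_cancel]
  exact sub_ne_zero.2 (sub_ne_zero.1 (sub_ne_zero_of_mem_disk hσ hz)).symm

end BoundaryFixedPoint

section Membership

variable {n : ℕ} {τ : ℂ} {σ : Fin n → ℂ} {Λ : Fin n → ℝ} {G : ℂ → ℂ} {ω : ℝ}

theorem HasSpectralValueAt.congr {G' : ℂ → ℂ} (h : HasSpectralValueAt G τ ω)
    (heq : EqOn G G' disk) : HasSpectralValueAt G' τ ω := by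
  obtain ⟨φ, hφ, hgen, hc⟩ := h
  refine ⟨φ, hφ, ⟨hgen.1.congr fun z hz => (heq hz).symm, fun z hz t ht => ?_⟩, hc⟩
  rw [← heq (hφ.mapsTo t ht hz)]
  exact hgen.2 z hz t ht

theorem mem_gen_of_tendsto (hτ : ‖τ‖ = 1) (hσ : ∀ k, ‖σ k‖ = 1) (hG : DifferentiableOn ℂ G disk)
    (hpos : ∀ z ∈ disk, 0 < (berksonPorta τ G z).re) (hω : 0 ≤ ω)
    (hlim : Tendsto (fun z => G z / (τ - z)) (𝓝[disk] τ) (𝓝 (ω : ℂ)))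
    (hlimσ : ∀ k, ∃ μ : ℝ, Λ k ≤ μ ∧ μ ≤ 0 ∧
      Tendsto (fun z => G z / (σ k - z)) (𝓝[disk] (σ k)) (𝓝 (μ : ℂ))) :
    G ∈ Gen τ σ Λ ∧ HasSpectralValueAt G τ ω := by
  obtain ⟨φ, hφ, hgen, hfix⟩ := exists_semigroup hτ hG hpos
  have hderiv := fun t ht => flow_hasAngularDerivAtFixed hτ hφ hgen hlim (t := t) ht
  refine ⟨⟨φ, hφ, hgen, fun t ht hid => ?_, fun k => ?_⟩, φ, hφ, hgen, hderiv⟩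
  · have ht0 : 0 < t := ht.lt_of_ne fun h0 => hid fun z hz => by rw [← h0, hφ.zero z hz, id]
    refine Or.inr ⟨hfix t ht0, _, ?_, hderiv t ht⟩
    rw [Real.exp_le_one_iff, neg_nonpos]
    positivity
  · obtain ⟨μ, hμΛ, hμ0, hμ⟩ := hlimσ k
    exact ⟨μ, hμΛ, hμ0, fun t ht => ⟨_, flow_hasAngularDerivAtFixed (hσ k) hφ hgen hμ ht⟩,
      hasAngularLimit_of_tendsto_disk hμ⟩

theorem zero_mem_gen (hτ : ‖τ‖ = 1) (hσ : ∀ k, ‖σ k‖ = 1) (hΛ : ∀ k, Λ k ≤ 0) :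
    (fun _ => 0) ∈ Gen τ σ Λ ∧ HasSpectralValueAt (fun _ => 0) τ 0 := by
  have hsg : IsOneParamSemigroup fun _ z => z :=
    ⟨fun _ _ => differentiableOn_id, fun _ _ => mapsTo_id _, fun _ _ => rfl,
      fun _ _ _ _ _ _ => rfl, fun _ _ => tendsto_const_nhds⟩
  have hgen : IsGeneratorOf (fun _ => 0) fun _ z => z :=
    ⟨differentiableOn_const _, fun z _ t _ => hasDerivWithinAt_const t (Ici 0) z⟩
  have hlim : ∀ s : ℂ, Tendsto (fun z : ℂ => (0 : ℂ) / (s - z)) (𝓝[disk] s) (𝓝 ((0 : ℝ) : ℂ)) :=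
    fun s => by simpa using tendsto_const_nhds
  exact ⟨⟨_, hsg, hgen, fun t _ hid => absurd (fun z _ => rfl) hid, fun k =>
    ⟨0, hΛ k, le_rfl, fun t ht => ⟨_, flow_hasAngularDerivAtFixed (hσ k) hsg hgen (hlim _) ht⟩,
      hasAngularLimit_of_tendsto_disk (hlim _)⟩⟩,
    _, hsg, hgen, fun t ht => flow_hasAngularDerivAtFixed hτ hsg hgen (hlim _) ht⟩

end Membership


/-! ### Boundary values of the Herglotz kernel -/

theorem herglotz_boundary {s τ : ℂ} (hs : ‖s‖ = 1) (hτ : ‖τ‖ = 1) (hne : s ≠ τ) :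
    herglotz s τ = Complex.I * ((2 * (conj s * τ).im / ‖τ - s‖ ^ 2 : ℝ) : ℂ) := by
  have hsub := sub_ne_zero.2 hne
  have hconj : conj (s - τ) ≠ 0 := (map_ne_zero _).2 hsub
  have hnorm : ((‖τ - s‖ ^ 2 : ℝ) : ℂ) = (s - τ) * conj (s - τ) := by
    rw [Complex.mul_conj, Complex.normSq_eq_norm_sq, norm_sub_rev]
  have him : (2 * (conj s * τ).im : ℂ) * Complex.I = conj s * τ - s * conj τ := by
    have h := Complex.sub_conj (conj s * τ)
    simp only [map_mul, Complex.conj_conj] at h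
    rw [h]
    push_cast
    ring
  rw [herglotz, Complex.ofReal_div, hnorm, ← mul_div_assoc,
    div_eq_div_iff hsub (mul_ne_zero hsub hconj)]
  push_cast
  rw [mul_comm Complex.I, him, map_sub]
  linear_combination (s - τ) * conj_mul_self_of_norm_one hs -
    (s - τ) * conj_mul_self_of_norm_one hτ

theorem one_sub_herglotz {s z : ℂ} (hne : s ≠ z) : 1 - herglotz s z = 2 * z / (z - s) := by
  have hsub := sub_ne_zero.2 hne
  rw [herglotz, one_sub_div hsub, div_eq_div_iff hsub (sub_ne_zero.2 hne.symm)]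
  ring

theorem inv_mul_one_sub_herglotz_re {s τ : ℂ} {a : ℝ} (hs : ‖s‖ = 1) (hτ : ‖τ‖ = 1) (hne : s ≠ τ)
    (ha : 0 < a) : (((a : ℂ) * (1 - herglotz s τ))⁻¹).re = ‖τ - s‖ ^ 2 / (4 * a) := by
  have hdist := norm_pos_iff.2 (sub_ne_zero.2 hne.symm)
  rw [inv_re_eq_div_norm_sq, Complex.re_ofReal_mul, Complex.sub_re, herglotz_re_boundary hs hτ,
    one_sub_herglotz hne, norm_mul, norm_div, norm_mul, hτ, Complex.norm_real,
    Real.norm_of_nonneg ha.le, Complex.norm_ofNat, Complex.one_re]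
  field_simp
  norm_num

theorem herglotz_sub_herglotz {s τ z : ℂ} (hτ : ‖τ‖ = 1) (hne : s ≠ τ)
    (hz : s ≠ z) : herglotz s z - herglotz s τ =
      (1 - conj τ * z) * (-(2 * s * τ) / ((s - z) * (s - τ))) := by
  have hsz := sub_ne_zero.2 hz
  have hsτ := sub_ne_zero.2 hne
  rw [one_sub_conj_mul_eq hτ, herglotz, herglotz, div_sub_div _ _ hsz hsτ, ← mul_div_assoc]
  congr 1
  linear_combination 2 * s * (τ - z) * conj_mul_self_of_norm_one hτ

theorem neg_two_mul_mul_div_sub_sq {s τ : ℂ} (hs : ‖s‖ = 1) (hτ : ‖τ‖ = 1) (hne : s ≠ τ) :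
    -(2 * s * τ) / ((s - τ) * (s - τ)) = ((2 / ‖τ - s‖ ^ 2 : ℝ) : ℂ) := by
  have hsub := sub_ne_zero.2 hne
  have hfactor := porta_factor_eq (τ := τ) hs
  have hdist : ((‖τ - s‖ ^ 2 : ℝ) : ℂ) ≠ 0 :=
    Complex.ofReal_ne_zero.2 (pow_ne_zero 2 (norm_ne_zero_iff.2 (sub_ne_zero.2 hne.symm)))
  rw [Complex.ofReal_div, div_eq_div_iff (mul_ne_zero hsub hsub) hdist]
  rw [one_sub_conj_mul_eq hτ] at hfactor
  push_cast at hfactor ⊢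
  linear_combination -2 * τ * hfactor + 2 * (τ - s) ^ 2 * conj_mul_self_of_norm_one hτ

theorem tendsto_herglotz_sub_div {s τ : ℂ} (hs : ‖s‖ = 1) (hτ : ‖τ‖ = 1) (hne : s ≠ τ) :
    Tendsto (fun z => (herglotz s z - herglotz s τ) / (1 - conj τ * z)) (𝓝[disk] τ)
      (𝓝 ((2 / ‖τ - s‖ ^ 2 : ℝ) : ℂ)) := by
  have hsub := sub_ne_zero.2 hne
  have hid : Tendsto (fun z : ℂ => z) (𝓝[disk] τ) (𝓝 τ) := nhdsWithin_le_nhds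
  have hlim : Tendsto (fun z => -(2 * s * τ) / ((s - z) * (s - τ))) (𝓝[disk] τ)
      (𝓝 (-(2 * s * τ) / ((s - τ) * (s - τ)))) :=
    tendsto_const_nhds.div ((hid.const_sub s).mul_const _) (mul_ne_zero hsub hsub)
  rw [neg_two_mul_mul_div_sub_sq hs hτ hne] at hlim
  refine hlim.congr' ?_
  filter_upwards [self_mem_nhdsWithin] with z hz
  have hz' : 1 - conj τ * z ≠ 0 := by
    rw [one_sub_conj_mul_eq hτ]
    exact mul_ne_zero (conj_ne_zero_of_norm_one hτ) (sub_ne_zero_of_mem_disk hτ hz)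
  rw [herglotz_sub_herglotz hτ hne (sub_ne_zero.1 (sub_ne_zero_of_mem_disk hs hz)),
    mul_div_cancel_left₀ _ hz']

theorem tendsto_sub_mul_of_tendsto {h : ℂ → ℂ} {s l : ℂ} (hlim : Tendsto h (𝓝[disk] s) (𝓝 l)) :
    Tendsto (fun z => (s - z) * h z) (𝓝[disk] s) (𝓝 0) := by
  have hid : Tendsto (fun z : ℂ => z) (𝓝[disk] s) (𝓝 s) := nhdsWithin_le_nhds
  simpa only [sub_self, zero_mul] using (hid.const_sub s).mul hlim

theorem tendsto_sub_mul_herglotz_self {s : ℂ} (hs : ‖s‖ = 1) :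
    Tendsto (fun z => (s - z) * herglotz s z) (𝓝[disk] s) (𝓝 (2 * s)) := by
  have hid : Tendsto (fun z : ℂ => z) (𝓝[disk] s) (𝓝 s) := nhdsWithin_le_nhds
  rw [two_mul]
  refine (hid.const_add s).congr' ?_
  filter_upwards [self_mem_nhdsWithin] with z hz
  rw [herglotz, mul_div_cancel₀ _ (sub_ne_zero_of_mem_disk hs hz)]

theorem tendsto_herglotz {s z : ℂ} (hne : s ≠ z) :
    Tendsto (herglotz s) (𝓝[disk] z) (𝓝 (herglotz s z)) :=
  (continuousAt_herglotz hne).tendsto.mono_left nhdsWithin_le_nhds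

/-! ### The function `p₀` -/

section PZero

variable {n : ℕ} {τ : ℂ} {σ : Fin n → ℂ} {Λ : Fin n → ℝ}

theorem alpha_pos (hτσ : ∀ k, τ ≠ σ k) (hΛ : ∀ k, Λ k < 0) (k : Fin n) : 0 < alpha τ σ Λ k := by
  have hdist := norm_pos_iff.2 (sub_ne_zero.2 (hτσ k))
  have habs := abs_pos.2 (hΛ k).ne
  rw [alpha]
  positivity

theorem alpha_mul_two_div (hτσ : ∀ k, τ ≠ σ k) (k : Fin n) :
    alpha τ σ Λ k * (2 / ‖τ - σ k‖ ^ 2) = |Λ k|⁻¹ := by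
  have hdist := norm_ne_zero_iff.2 (sub_ne_zero.2 (hτσ k))
  rw [alpha]
  field_simp

theorem sumAlpha_pos (hn : 1 ≤ n) (hτσ : ∀ k, τ ≠ σ k) (hΛ : ∀ k, Λ k < 0) :
    0 < sumAlpha τ σ Λ :=
  Finset.sum_pos (fun k _ => alpha_pos hτσ hΛ k) ⟨⟨0, hn⟩, Finset.mem_univ _⟩

theorem sumInv_pos (hn : 1 ≤ n) (hΛ : ∀ k, Λ k < 0) : 0 < sumInv Λ :=
  Finset.sum_pos (fun k _ => inv_pos.2 (abs_pos.2 (hΛ k).ne)) ⟨⟨0, hn⟩, Finset.mem_univ _⟩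

theorem p0_zero (hσ : ∀ k, ‖σ k‖ = 1) : p0 τ σ Λ 0 = sumAlpha τ σ Λ := by
  simp only [p0_eq, herglotz_zero (hσ _), mul_one, sumAlpha, Complex.ofReal_sum]

theorem p0_boundary (hτ : ‖τ‖ = 1) (hσ : ∀ k, ‖σ k‖ = 1) (hτσ : ∀ k, τ ≠ σ k) :
    p0 τ σ Λ τ = Complex.I * ((∑ k, |Λ k|⁻¹ * (conj (σ k) * τ).im : ℝ) : ℂ) := by
  rw [p0_eq, Complex.ofReal_sum, Finset.mul_sum]
  refine Finset.sum_congr rfl fun k _ => ?_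
  rw [herglotz_boundary (hσ k) hτ (hτσ k).symm, mul_left_comm, ← Complex.ofReal_mul,
    ← alpha_mul_two_div hτσ]
  congr 2
  ring

theorem p0_boundary_re (hτ : ‖τ‖ = 1) (hσ : ∀ k, ‖σ k‖ = 1) : (p0 τ σ Λ τ).re = 0 := by
  rw [p0_eq, Complex.re_sum]
  refine Finset.sum_eq_zero fun k _ => ?_
  rw [Complex.re_ofReal_mul, herglotz_re_boundary (hσ k) hτ, mul_zero]

theorem differentiableOn_p0 (hσ : ∀ k, ‖σ k‖ = 1) : DifferentiableOn ℂ (p0 τ σ Λ) disk :=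
  DifferentiableOn.fun_sum fun k _ => (differentiableOn_herglotz (hσ k)).const_mul _

theorem continuousAt_p0 {z : ℂ} (hσz : ∀ k, σ k ≠ z) : ContinuousAt (p0 τ σ Λ) z :=
  tendsto_finsetSum _ fun k _ => (continuousAt_herglotz (hσz k)).const_mul (alpha τ σ Λ k : ℂ)

theorem p0_re_pos (hn : 1 ≤ n) (hσ : ∀ k, ‖σ k‖ = 1) (hτσ : ∀ k, τ ≠ σ k) (hΛ : ∀ k, Λ k < 0)
    {z : ℂ} (hz : z ∈ disk) : 0 < (p0 τ σ Λ z).re := by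
  rw [p0_eq, Complex.re_sum]
  refine Finset.sum_pos (fun k _ => ?_) ⟨⟨0, hn⟩, Finset.mem_univ _⟩
  rw [Complex.re_ofReal_mul]
  exact mul_pos (alpha_pos hτσ hΛ k) (herglotz_re_pos (hσ k) hz)

theorem tendsto_p0_sub_div (hτ : ‖τ‖ = 1) (hσ : ∀ k, ‖σ k‖ = 1) (hτσ : ∀ k, τ ≠ σ k) :
    Tendsto (fun z => (p0 τ σ Λ z - p0 τ σ Λ τ) / (1 - conj τ * z)) (𝓝[disk] τ)
      (𝓝 (sumInv Λ : ℂ)) := by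
  have hlim := tendsto_finsetSum Finset.univ fun k (_ : k ∈ Finset.univ) =>
    (tendsto_herglotz_sub_div (hσ k) hτ (hτσ k).symm).const_mul (alpha τ σ Λ k : ℂ)
  simp only [← Complex.ofReal_mul, alpha_mul_two_div hτσ, ← Complex.ofReal_sum] at hlim
  refine hlim.congr fun z => ?_
  rw [p0_eq, p0_eq, ← Finset.sum_sub_distrib, Finset.sum_div]
  exact Finset.sum_congr rfl fun k _ => by ring

theorem tendsto_sub_mul_p0 (hinj : Function.Injective σ) (hσ : ∀ k, ‖σ k‖ = 1) (k : Fin n) :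
    Tendsto (fun z => (σ k - z) * p0 τ σ Λ z) (𝓝[disk] (σ k))
      (𝓝 (2 * σ k * (alpha τ σ Λ k : ℂ))) := by
  have hterm : ∀ j ∈ Finset.univ,
      Tendsto (fun z => (alpha τ σ Λ j : ℂ) * ((σ k - z) * herglotz (σ j) z)) (𝓝[disk] (σ k))
        (𝓝 (if j = k then (alpha τ σ Λ k : ℂ) * (2 * σ k) else 0)) := by
    intro j _
    split_ifs with hjk
    · exact hjk ▸ (tendsto_sub_mul_herglotz_self (hσ j)).const_mul _
    · simpa only [mul_zero] using
        (tendsto_sub_mul_of_tendsto (tendsto_herglotz (hinj.ne hjk))).const_mul _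
  have hsum := tendsto_finsetSum Finset.univ hterm
  rw [Finset.sum_ite_eq' Finset.univ k, if_pos (Finset.mem_univ k), mul_comm] at hsum
  refine hsum.congr fun z => ?_
  rw [p0_eq, Finset.mul_sum]
  exact Finset.sum_congr rfl fun j _ => mul_left_comm _ _ _

end PZero

/-! ### Generators with prescribed parameter -/

theorem tendsto_porta_factor_div {τ s : ℂ} (hs : ‖s‖ = 1) {q : ℂ → ℂ} {a : ℝ} (ha : a ≠ 0)
    (hq : Tendsto (fun z => (s - z) * q z) (𝓝[disk] s) (𝓝 (2 * s * (a : ℂ)))) :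
    Tendsto (fun z => (τ - z) * (1 - conj τ * z) / q z / (s - z)) (𝓝[disk] s)
      (𝓝 ((-(‖τ - s‖ ^ 2 / (2 * a)) : ℝ) : ℂ)) := by
  have hs0 := ne_zero_of_norm_one hs
  have ha0 := Complex.ofReal_ne_zero.2 ha
  have hid : Tendsto (fun z : ℂ => z) (𝓝[disk] s) (𝓝 s) := nhdsWithin_le_nhds
  have hlim := ((hid.const_sub τ).mul ((hid.const_mul (conj τ)).const_sub 1)).div hq
    (mul_ne_zero (mul_ne_zero two_ne_zero hs0) ha0)
  have hvalue : (τ - s) * (1 - conj τ * s) / (2 * s * (a : ℂ)) =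
      ((-(‖τ - s‖ ^ 2 / (2 * a)) : ℝ) : ℂ) := by
    rw [porta_factor_eq hs]
    push_cast
    field_simp
  rw [hvalue] at hlim
  refine hlim.congr fun z => ?_
  rw [div_div, mul_comm (q z)]
  rfl

/-- The generator whose Berkson–Porta function is the reciprocal of `p0 - p0 τ + h`. By
`exists_eq_paramGen`, letting `h` range over holomorphic functions with nonnegative real part
gives every generator in `Gen τ σ Λ` that does not vanish at the origin. -/
def paramGen {n : ℕ} (τ : ℂ) (σ : Fin n → ℂ) (Λ : Fin n → ℝ) (h : ℂ → ℂ) (z : ℂ) : ℂ :=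
  (τ - z) * (1 - conj τ * z) / (p0 τ σ Λ z - p0 τ σ Λ τ + h z)

section ParamGen

variable {n : ℕ} {τ : ℂ} {σ : Fin n → ℂ} {Λ : Fin n → ℝ} {h : ℂ → ℂ}

theorem berksonPorta_paramGen (hτ : ‖τ‖ = 1) (h : ℂ → ℂ) {z : ℂ} (hz : z ∈ disk) :
    berksonPorta τ (paramGen τ σ Λ h) z = (p0 τ σ Λ z - p0 τ σ Λ τ + h z)⁻¹ := by
  rw [berksonPorta, paramGen, div_div, mul_comm (_ + _), ← div_div,
    div_self (porta_factor_ne_zero hτ hz), one_div]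

theorem paramGen_div_sub {z : ℂ} (hz : τ - z ≠ 0) :
    paramGen τ σ Λ h z / (τ - z) = (1 - conj τ * z) / (p0 τ σ Λ z - p0 τ σ Λ τ + h z) := by
  rw [paramGen, div_right_comm, mul_div_cancel_left₀ _ hz]

theorem p0_sub_add_re_pos (hn : 1 ≤ n) (hτ : ‖τ‖ = 1) (hσ : ∀ k, ‖σ k‖ = 1) (hτσ : ∀ k, τ ≠ σ k)
    (hΛ : ∀ k, Λ k < 0) {z w : ℂ} (hz : z ∈ disk) (hw : 0 ≤ w.re) :
    0 < (p0 τ σ Λ z - p0 τ σ Λ τ + w).re := by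
  rw [Complex.add_re, Complex.sub_re, p0_boundary_re hτ hσ, sub_zero]
  exact add_pos_of_pos_of_nonneg (p0_re_pos hn hσ hτσ hΛ hz) hw

theorem exists_tendsto_paramGen_div_sub (hσ : ∀ k, ‖σ k‖ = 1) (hinj : Function.Injective σ)
    (hτσ : ∀ k, τ ≠ σ k) (hΛ : ∀ k, Λ k < 0) (k : Fin n) {β : ℝ} (hβ : 0 ≤ β)
    (hlim : Tendsto (fun z => (σ k - z) * h z) (𝓝[disk] (σ k)) (𝓝 (2 * σ k * (β : ℂ)))) :
    ∃ μ : ℝ, Λ k ≤ μ ∧ μ ≤ 0 ∧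
      Tendsto (fun z => paramGen τ σ Λ h z / (σ k - z)) (𝓝[disk] (σ k)) (𝓝 (μ : ℂ)) := by
  have hα := alpha_pos hτσ hΛ k
  have hdist := norm_pos_iff.2 (sub_ne_zero.2 (hτσ k))
  refine ⟨-(‖τ - σ k‖ ^ 2 / (2 * (alpha τ σ Λ k + β))), ?_, neg_nonpos.2 (by positivity),
    tendsto_porta_factor_div (hσ k) (by positivity) ?_⟩
  · have hΛk : Λ k = -(‖τ - σ k‖ ^ 2 / (2 * alpha τ σ Λ k)) := by
      have := (hΛ k).ne
      rw [alpha, abs_of_neg (hΛ k)]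
      field_simp
    rw [hΛk, neg_le_neg_iff]
    gcongr
    exact le_add_of_nonneg_right hβ
  · have hconst := tendsto_sub_mul_of_tendsto
      (tendsto_const_nhds (x := p0 τ σ Λ τ) (f := 𝓝[disk] (σ k)))
    convert ((tendsto_sub_mul_p0 (τ := τ) (Λ := Λ) hinj hσ k).sub hconst).add hlim using 2
    · ring
    · push_cast
      ring

theorem paramGen_mem (hn : 1 ≤ n) (hτ : ‖τ‖ = 1) (hσ : ∀ k, ‖σ k‖ = 1)
    (hinj : Function.Injective σ) (hτσ : ∀ k, τ ≠ σ k) (hΛ : ∀ k, Λ k < 0)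
    (hd : DifferentiableOn ℂ h disk) (hpos : ∀ z ∈ disk, 0 ≤ (h z).re) {ω : ℝ} (hω : 0 ≤ ω)
    (hlim : Tendsto (fun z => paramGen τ σ Λ h z / (τ - z)) (𝓝[disk] τ) (𝓝 (ω : ℂ)))
    (hlimσ : ∀ k, ∃ β : ℝ, 0 ≤ β ∧
      Tendsto (fun z => (σ k - z) * h z) (𝓝[disk] (σ k)) (𝓝 (2 * σ k * (β : ℂ)))) :
    paramGen τ σ Λ h ∈ Gen τ σ Λ ∧ HasSpectralValueAt (paramGen τ σ Λ h) τ ω := by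
  have hre := fun z (hz : z ∈ disk) => p0_sub_add_re_pos hn hτ hσ hτσ hΛ hz (hpos z hz)
  refine mem_gen_of_tendsto hτ hσ ?_ (fun z hz => ?_) hω hlim fun k => ?_
  · exact DifferentiableOn.div (by fun_prop) (((differentiableOn_p0 hσ).sub_const _).add hd)
      fun z hz => ne_zero_of_re_pos (hre z hz)
  · rw [berksonPorta_paramGen hτ h hz]
    exact inv_re_pos (hre z hz)
  · obtain ⟨β, hβ, hlimβ⟩ := hlimσ k
    exact exists_tendsto_paramGen_div_sub hσ hinj hτσ hΛ k hβ hlimβ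

theorem tendsto_paramGen_div_of_ne_zero (hτ : ‖τ‖ = 1) (hτσ : ∀ k, τ ≠ σ k) {w : ℂ} (hw : w ≠ 0)
    (hlim : Tendsto h (𝓝[disk] τ) (𝓝 w)) :
    Tendsto (fun z => paramGen τ σ Λ h z / (τ - z)) (𝓝[disk] τ) (𝓝 0) := by
  have hid : Tendsto (fun z : ℂ => z) (𝓝[disk] τ) (𝓝 τ) := nhdsWithin_le_nhds
  have hp0 := (continuousAt_p0 (τ := τ) (Λ := Λ) fun k => (hτσ k).symm).tendsto.mono_left
    (nhdsWithin_le_nhds (s := disk))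
  have hquot := ((hid.const_mul (conj τ)).const_sub 1).div
    ((hp0.sub_const (p0 τ σ Λ τ)).add hlim) (by rwa [sub_self, zero_add])
  rw [conj_mul_self_of_norm_one hτ, sub_self, zero_div] at hquot
  refine hquot.congr' ?_
  filter_upwards [self_mem_nhdsWithin] with z hz
  exact (paramGen_div_sub (sub_ne_zero_of_mem_disk hτ hz)).symm

theorem tendsto_paramGen_div_of_tendsto_div (hn : 1 ≤ n) (hτ : ‖τ‖ = 1) (hσ : ∀ k, ‖σ k‖ = 1)
    (hτσ : ∀ k, τ ≠ σ k) (hΛ : ∀ k, Λ k < 0) {d : ℝ} (hd : 0 ≤ d)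
    (hlim : Tendsto (fun z => h z / (1 - conj τ * z)) (𝓝[disk] τ) (𝓝 (d : ℂ))) :
    Tendsto (fun z => paramGen τ σ Λ h z / (τ - z)) (𝓝[disk] τ)
      (𝓝 (((sumInv Λ + d)⁻¹ : ℝ) : ℂ)) := by
  have hS := sumInv_pos hn hΛ
  have hadd := (tendsto_p0_sub_div (Λ := Λ) hτ hσ hτσ).add hlim
  rw [← Complex.ofReal_add] at hadd
  have hinv := hadd.inv₀ (Complex.ofReal_ne_zero.2 (by positivity))
  rw [← Complex.ofReal_inv] at hinv
  refine hinv.congr' ?_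
  filter_upwards [self_mem_nhdsWithin] with z hz
  rw [← add_div, inv_div, paramGen_div_sub (sub_ne_zero_of_mem_disk hτ hz)]

theorem exists_tendsto_sub_mul_of_tendsto {s l : ℂ} (hlim : Tendsto h (𝓝[disk] s) (𝓝 l)) :
    ∃ β : ℝ, 0 ≤ β ∧ Tendsto (fun z => (s - z) * h z) (𝓝[disk] s) (𝓝 (2 * s * (β : ℂ))) :=
  ⟨0, le_rfl, by simpa using tendsto_sub_mul_of_tendsto hlim⟩

theorem paramGen_const_mem (hn : 1 ≤ n) (hτ : ‖τ‖ = 1) (hσ : ∀ k, ‖σ k‖ = 1)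
    (hinj : Function.Injective σ) (hτσ : ∀ k, τ ≠ σ k) (hΛ : ∀ k, Λ k < 0) {w : ℂ} (hw : w ≠ 0)
    (hre : 0 ≤ w.re) : paramGen τ σ Λ (fun _ => w) ∈ Gen τ σ Λ ∧
      HasSpectralValueAt (paramGen τ σ Λ fun _ => w) τ 0 :=
  paramGen_mem hn hτ hσ hinj hτσ hΛ (differentiableOn_const _) (fun _ _ => hre) le_rfl
    (by simpa using tendsto_paramGen_div_of_ne_zero hτ hτσ hw tendsto_const_nhds)
    fun _ => exists_tendsto_sub_mul_of_tendsto tendsto_const_nhds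

theorem paramGen_zero_mem (hn : 1 ≤ n) (hτ : ‖τ‖ = 1) (hσ : ∀ k, ‖σ k‖ = 1)
    (hinj : Function.Injective σ) (hτσ : ∀ k, τ ≠ σ k) (hΛ : ∀ k, Λ k < 0) :
    paramGen τ σ Λ (fun _ => 0) ∈ Gen τ σ Λ ∧
      HasSpectralValueAt (paramGen τ σ Λ fun _ => 0) τ (sumInv Λ)⁻¹ := by
  have hlim := tendsto_paramGen_div_of_tendsto_div (σ := σ) (h := fun _ => 0) hn hτ hσ hτσ hΛ le_rfl
    (by simpa using tendsto_const_nhds)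
  rw [add_zero] at hlim
  exact paramGen_mem hn hτ hσ hinj hτσ hΛ (differentiableOn_const _) (fun _ _ => le_rfl)
    (inv_nonneg.2 (sumInv_pos hn hΛ).le) hlim
    fun _ => exists_tendsto_sub_mul_of_tendsto tendsto_const_nhds

theorem tendsto_inv_mul_herglotz_add_div (hτ : ‖τ‖ = 1) {m : ℝ} (hm : m ≠ 0) (b : ℂ) :
    Tendsto (fun z => ((m : ℂ) * herglotz τ z + b)⁻¹ / (1 - conj τ * z)) (𝓝[disk] τ)
      (𝓝 (((2 * m)⁻¹ : ℝ) : ℂ)) := by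
  have hlim := (((tendsto_sub_mul_herglotz_self hτ).const_mul (m : ℂ)).add
    (tendsto_sub_mul_of_tendsto (tendsto_const_nhds (x := b)))).const_mul (conj τ)
  have hvalue : conj τ * ((m : ℂ) * (2 * τ) + 0) = ((2 * m : ℝ) : ℂ) := by
    push_cast
    linear_combination 2 * m * conj_mul_self_of_norm_one hτ
  rw [hvalue] at hlim
  have hinv := hlim.inv₀ (Complex.ofReal_ne_zero.2 (mul_ne_zero two_ne_zero hm))
  rw [← Complex.ofReal_inv] at hinv
  refine hinv.congr fun z => ?_
  rw [one_sub_conj_mul_eq hτ, div_eq_mul_inv, ← mul_inv]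
  congr 1
  ring

theorem paramGen_inv_mem (hn : 1 ≤ n) (hτ : ‖τ‖ = 1) (hσ : ∀ k, ‖σ k‖ = 1)
    (hinj : Function.Injective σ) (hτσ : ∀ k, τ ≠ σ k) (hΛ : ∀ k, Λ k < 0) {m : ℝ} (hm : 0 < m)
    {b : ℂ} (hb : 0 < b.re) :
    paramGen τ σ Λ (fun z => (m * herglotz τ z + b)⁻¹) ∈ Gen τ σ Λ ∧
      HasSpectralValueAt (paramGen τ σ Λ fun z => (m * herglotz τ z + b)⁻¹) τ
        (sumInv Λ + (2 * m)⁻¹)⁻¹ := by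
  have hre : ∀ z, 0 ≤ (herglotz τ z).re → 0 < ((m : ℂ) * herglotz τ z + b).re := by
    intro z hz
    rw [Complex.add_re, Complex.re_ofReal_mul]
    positivity
  have hdisk := fun z hz => hre z (herglotz_re_pos hτ hz).le
  have hS := sumInv_pos hn hΛ
  refine paramGen_mem hn hτ hσ hinj hτσ hΛ ?_ (fun z hz => (inv_re_pos (hdisk z hz)).le)
    (by positivity) (tendsto_paramGen_div_of_tendsto_div hn hτ hσ hτσ hΛ (by positivity)
      (tendsto_inv_mul_herglotz_add_div hτ hm.ne' b)) fun k => ?_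
  · exact (((differentiableOn_herglotz hτ).const_mul _).add_const _).inv fun z hz =>
      ne_zero_of_re_pos (hdisk z hz)
  · exact exists_tendsto_sub_mul_of_tendsto ((((tendsto_herglotz (hτσ k)).const_mul _).add_const
      _).inv₀ (ne_zero_of_re_pos (hre _ (herglotz_re_boundary hτ (hσ k)).ge)))

theorem paramGen_herglotz_mem (hn : 1 ≤ n) (hτ : ‖τ‖ = 1) (hσ : ∀ k, ‖σ k‖ = 1)
    (hinj : Function.Injective σ) (hτσ : ∀ k, τ ≠ σ k) (hΛ : ∀ k, Λ k < 0) {a : ℝ} (ha : 0 ≤ a)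
    {s : ℂ} (hs : ‖s‖ = 1) (hsτ : s ≠ τ) :
    paramGen τ σ Λ (fun z => a * (herglotz s z - herglotz s τ)) ∈ Gen τ σ Λ ∧
      HasSpectralValueAt (paramGen τ σ Λ fun z => a * (herglotz s z - herglotz s τ)) τ
        (sumInv Λ + a * (2 / ‖τ - s‖ ^ 2))⁻¹ := by
  have hS := sumInv_pos hn hΛ
  refine paramGen_mem hn hτ hσ hinj hτσ hΛ
    (((differentiableOn_herglotz hs).sub_const _).const_mul _) (fun z hz => ?_) (by positivity)
    (tendsto_paramGen_div_of_tendsto_div hn hτ hσ hτσ hΛ (by positivity) ?_) fun k => ?_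
  · rw [Complex.re_ofReal_mul, Complex.sub_re, herglotz_re_boundary hs hτ, sub_zero]
    exact mul_nonneg ha (herglotz_re_pos hs hz).le
  · have hlim := (tendsto_herglotz_sub_div hs hτ hsτ).const_mul (a : ℂ)
    rw [← Complex.ofReal_mul] at hlim
    exact hlim.congr fun z => (mul_div_assoc _ _ _).symm
  · by_cases hk : s = σ k
    · rw [← hk]
      refine ⟨a, ha, ?_⟩
      convert ((tendsto_sub_mul_herglotz_self hs).sub (tendsto_sub_mul_of_tendsto
        (tendsto_const_nhds (x := herglotz s τ)))).const_mul (a : ℂ) using 2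
      · ring
      · ring
    · exact exists_tendsto_sub_mul_of_tendsto
        (((tendsto_herglotz hk).sub_const (herglotz s τ)).const_mul (a : ℂ))

end ParamGen


section ParamValue

variable {n : ℕ} {τ : ℂ} {σ : Fin n → ℂ} {Λ : Fin n → ℝ}

/-- The value at the origin of the function `h` that parametrizes, through `paramGen`, a generator
`G` with `G 0 = ζ`. -/
def paramValue {n : ℕ} (τ : ℂ) (σ : Fin n → ℂ) (Λ : Fin n → ℝ) (ζ : ℂ) : ℂ :=
  ell τ σ Λ ζ + p0 τ σ Λ τ

theorem paramValue_re (hτ : ‖τ‖ = 1) (hσ : ∀ k, ‖σ k‖ = 1) (ζ : ℂ) :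
    (paramValue τ σ Λ ζ).re = (ell τ σ Λ ζ).re := by
  rw [paramValue, Complex.add_re, p0_boundary_re hτ hσ, add_zero]

theorem paramGen_apply_zero (hτ : ‖τ‖ = 1) (hσ : ∀ k, ‖σ k‖ = 1) {h : ℂ → ℂ} {ζ : ℂ}
    (h0 : h 0 = paramValue τ σ Λ ζ) : paramGen τ σ Λ h 0 = ζ := by
  have hτ0 := ne_zero_of_norm_one hτ
  have hden : p0 τ σ Λ 0 - p0 τ σ Λ τ + h 0 = τ / ζ := by
    rw [h0, paramValue, ell, p0_zero hσ]
    ring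
  rw [paramGen, hden, sub_zero, mul_zero, sub_zero, mul_one, div_div_cancel₀ hτ0]

theorem exists_eq_paramGen (hn : 1 ≤ n) (hτ : ‖τ‖ = 1) (hσ : ∀ k, ‖σ k‖ = 1)
    (hinj : Function.Injective σ) (hτσ : ∀ k, τ ≠ σ k) {G : ℂ → ℂ} (hG : G ∈ Gen τ σ Λ)
    (hG0 : G 0 ≠ 0) :
    ∃ h : ℂ → ℂ, DifferentiableOn ℂ h disk ∧ (∀ z ∈ disk, 0 ≤ (h z).re) ∧
      h 0 = paramValue τ σ Λ (G 0) ∧ EqOn G (paramGen τ σ Λ h) disk := by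
  have hpos := (eq_zero_or_berksonPorta_re_pos hn hτ hσ hτσ hG).resolve_left
    fun h => hG0 (h 0 zero_mem_disk)
  have hd := differentiableOn_berksonPorta hτ (differentiableOn_of_mem_gen hG)
  refine ⟨fun z => (berksonPorta τ G z)⁻¹ - p0 τ σ Λ z + p0 τ σ Λ τ,
    ((hd.inv fun z hz => ne_zero_of_re_pos (hpos z hz)).sub (differentiableOn_p0 hσ)).add_const _,
    fun z hz => ?_, ?_, fun z hz => ?_⟩
  · rw [Complex.add_re, Complex.sub_re, p0_boundary_re hτ hσ, add_zero, sub_nonneg]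
    exact p0_re_le_inv_berksonPorta_re hσ hinj hτ hτσ hG hpos hz
  · simp only [berksonPorta, paramValue, ell, p0_zero hσ, sub_zero, mul_zero, mul_one, inv_div]
  · have hden : p0 τ σ Λ z - p0 τ σ Λ τ + ((berksonPorta τ G z)⁻¹ - p0 τ σ Λ z + p0 τ σ Λ τ) =
        (berksonPorta τ G z)⁻¹ := by ring
    rw [paramGen, hden, div_inv_eq_mul, berksonPorta,
      mul_div_cancel₀ _ (porta_factor_ne_zero hτ hz)]

theorem fRatio_eq {w : ℂ} (hw : 0 < w.re) :
    fRatio Λ w = (sumInv Λ + (2 * (w⁻¹).re)⁻¹)⁻¹ := by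
  have := ne_zero_of_re_pos hw
  rw [fRatio, inv_re_eq_div_norm_sq, ← inv_div]
  congr 1
  field_simp
  ring

theorem omegaMax_eq (hτ : ‖τ‖ = 1) (hσ : ∀ k, ‖σ k‖ = 1) (hτσ : ∀ k, τ ≠ σ k) {ζ : ℂ}
    (hre : 0 < (ell τ σ Λ ζ).re) :
    omegaMax τ σ Λ ζ = (sumInv Λ + (2 * ((paramValue τ σ Λ ζ)⁻¹).re)⁻¹)⁻¹ := by
  rw [omegaMax, ← p0_boundary hτ hσ hτσ, ← paramValue,
    fRatio_eq ((paramValue_re hτ hσ ζ).symm ▸ hre)]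

end ParamValue

/-! ### The upper bound for the spectral value -/

section UpperBound

variable {n : ℕ} {τ : ℂ} {σ : Fin n → ℂ} {Λ : Fin n → ℝ}

theorem norm_inv_berksonPorta_radial_le (hτ : ‖τ‖ = 1) {G : ℂ → ℂ} {ω : ℝ} (hω : 0 < ω)
    (hsp : HasSpectralValueAt G τ ω) {r : ℝ} (hr : r ∈ Ioo (0 : ℝ) 1) :
    ‖(berksonPorta τ G (r * τ))⁻¹‖ ≤ (1 - r) * (2 / (ω * (1 + r))) := by
  have hr0 := hr.1
  have hr1 := sub_pos.2 hr.2
  have hmul : ω * (1 + r) / (1 - r) ≤ 2 * ‖berksonPorta τ G (r * τ)‖ := by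
    rw [← herglotz_radial_re hτ hr, mul_div_assoc, mul_div_cancel_left₀ _ hr1.ne']
    refine (mul_re_herglotz_le_berksonPorta hsp (radial_mem_disk hτ hr)).trans ?_
    gcongr
    exact Complex.re_le_norm _
  have hpos : 0 < ‖berksonPorta τ G (r * τ)‖ := by
    have : 0 < ω * (1 + r) / (1 - r) := by positivity
    linarith
  rw [div_le_iff₀ hr1] at hmul
  rw [norm_inv, ← mul_div_assoc, le_div_iff₀ (by positivity), inv_mul_le_iff₀ hpos]
  linarith

theorem tendsto_two_div_mul_one_add {ω : ℝ} (hω : ω ≠ 0) :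
    Tendsto (fun r : ℝ => 2 / (ω * (1 + r))) (𝓝[<] 1) (𝓝 ω⁻¹) := by
  have hid : Tendsto (fun r : ℝ => r) (𝓝[<] 1) (𝓝 1) := nhdsWithin_le_nhds
  have hlim := (tendsto_const_nhds (x := (2 : ℝ))).div ((hid.const_add 1).const_mul ω)
    (by norm_num [hω])
  rwa [one_add_one_eq_two, div_mul_cancel_right₀ two_ne_zero] at hlim

theorem inv_berksonPorta_paramGen_eq_p0 (hτ : ‖τ‖ = 1) (h : ℂ → ℂ) {z : ℂ} (hz : z ∈ disk) :
    (berksonPorta τ (paramGen τ σ Λ h) z)⁻¹ - (p0 τ σ Λ z - p0 τ σ Λ τ) = h z := by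
  rw [berksonPorta_paramGen hτ h hz, inv_inv, add_sub_cancel_left]

/-- Julia's lemma for `1 / h`: the spectral value and `p0` together determine the angular
derivative of `h` at its boundary zero `τ`. -/
theorem herglotz_re_le_of_hasSpectralValueAt_paramGen (hτ : ‖τ‖ = 1) (hσ : ∀ k, ‖σ k‖ = 1)
    (hτσ : ∀ k, τ ≠ σ k) {h : ℂ → ℂ} {ω : ℝ} (hd : DifferentiableOn ℂ h disk)
    (hpos : ∀ z ∈ disk, 0 < (h z).re) (hω : 0 < ω)
    (hsp : HasSpectralValueAt (paramGen τ σ Λ h) τ ω) {z : ℂ} (hz : z ∈ disk) :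
    (herglotz τ z).re ≤ 2 * (ω⁻¹ - sumInv Λ) * ((h z)⁻¹).re := by
  have hbound : ∀ᶠ r : ℝ in 𝓝[<] 1, ‖(berksonPorta τ (paramGen τ σ Λ h) (r * τ))⁻¹‖ ≤
      (1 - r) * (2 / (ω * (1 + r))) :=
    eventually_mem_Ioo.mono fun r hr => norm_inv_berksonPorta_radial_le hτ hω hsp hr
  have hcoef := tendsto_two_div_mul_one_add hω.ne'
  have hid : Tendsto (fun r : ℝ => r) (𝓝[<] 1) (𝓝 1) := nhdsWithin_le_nhds
  have hinv := squeeze_zero_norm' hbound (by simpa using (hid.const_sub 1).mul hcoef)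
  have hp0 := (continuousAt_p0 (τ := τ) (Λ := Λ) fun k => (hτσ k).symm).tendsto.comp
    (tendsto_radial τ)
  have hderiv := (Complex.continuous_re.tendsto _).comp
    ((tendsto_p0_sub_div (Λ := Λ) hτ hσ hτσ).comp (tendsto_radial_disk hτ))
  rw [Complex.ofReal_re] at hderiv
  have := norm_pos_iff.2 (ne_zero_of_re_pos (hpos z hz))
  rw [inv_re_eq_div_norm_sq, ← mul_div_assoc, le_div_iff₀ (by positivity)]
  refine re_herglotz_mul_norm_sq_le_of_radial hτ hd (fun z hz => (hpos z hz).le) ?_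
    (hcoef.sub hderiv) ?_ hz
  · have hsub := hinv.sub (hp0.sub_const (p0 τ σ Λ τ))
    rw [sub_self, sub_zero] at hsub
    refine hsub.congr' ?_
    filter_upwards [eventually_mem_Ioo] with r hr
    exact inv_berksonPorta_paramGen_eq_p0 hτ h (radial_mem_disk hτ hr)
  · filter_upwards [eventually_mem_Ioo, hbound] with r hr hle
    have hr1 := sub_pos.2 hr.2
    have hfactor : 1 - conj τ * (r * τ) = ((1 - r : ℝ) : ℂ) := by
      push_cast
      linear_combination (-(r : ℂ)) * conj_mul_self_of_norm_one hτ
    rw [← inv_berksonPorta_paramGen_eq_p0 (σ := σ) (Λ := Λ) hτ h (radial_mem_disk hτ hr), mul_sub,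
      Function.comp_apply, Function.comp_apply, hfactor, Complex.div_ofReal_re,
      mul_div_cancel₀ _ hr1.ne', Complex.sub_re]
    gcongr
    exact (Complex.re_le_norm _).trans hle

theorem spectralValue_nonneg (hτ : ‖τ‖ = 1) {G : ℂ → ℂ} {ω : ℝ} (hG : G ∈ Gen τ σ Λ)
    (hω : HasSpectralValueAt G τ ω) : 0 ≤ ω := by
  obtain ⟨ω', hω'0, hω'⟩ := exists_spectralValue hτ hG
  exact (hω.unique hω').symm ▸ hω'0

theorem spectralValue_le_omegaMax (hn : 1 ≤ n) (hτ : ‖τ‖ = 1) (hσ : ∀ k, ‖σ k‖ = 1)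
    (hinj : Function.Injective σ) (hτσ : ∀ k, τ ≠ σ k) (hΛ : ∀ k, Λ k < 0) {G : ℂ → ℂ} {ω : ℝ}
    (hG : G ∈ Gen τ σ Λ) (hG0 : G 0 ≠ 0) (hre : 0 < (ell τ σ Λ (G 0)).re)
    (hω : HasSpectralValueAt G τ ω) : ω ≤ omegaMax τ σ Λ (G 0) := by
  have hS := sumInv_pos hn hΛ
  rw [omegaMax_eq hτ hσ hτσ hre]
  rw [← paramValue_re hτ hσ] at hre
  have hinv := inv_re_pos hre
  rcases (spectralValue_nonneg hτ hG hω).eq_or_lt with rfl | hω0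
  · positivity
  obtain ⟨h, hd, hpos, h0, heq⟩ := exists_eq_paramGen hn hτ hσ hinj hτσ hG hG0
  have hjulia := herglotz_re_le_of_hasSpectralValueAt_paramGen hτ hσ hτσ hd
    (re_pos_of_re_zero_pos hd hpos (h0 ▸ hre)) hω0 (hω.congr heq) zero_mem_disk
  rw [h0, herglotz_zero hτ, Complex.one_re, mul_right_comm,
    ← inv_le_iff_one_le_mul₀' (by positivity)] at hjulia
  rw [le_inv_comm₀ hω0 (by positivity)]
  linarith

theorem eq_add_re_mul_herglotz_of_le (hτ : ‖τ‖ = 1) {g : ℂ → ℂ} (hd : DifferentiableOn ℂ g disk)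
    (hle : ∀ z ∈ disk, (g 0).re * (herglotz τ z).re ≤ (g z).re) {z : ℂ} (hz : z ∈ disk) :
    g z = g 0 + (g 0).re * (herglotz τ z - 1) := by
  have hconst := eq_of_re_eq_zero (h := fun z => g z - (g 0).re * herglotz τ z)
    (hd.sub ((differentiableOn_herglotz hτ).const_mul _))
    (fun z hz => by
      rw [Complex.sub_re, Complex.re_ofReal_mul]
      exact sub_nonneg.2 (hle z hz))
    zero_mem_disk (by simp [herglotz_zero hτ]) z hz
  simp only [herglotz_zero hτ] at hconst
  linear_combination hconst

theorem eqOn_paramGen_of_spectralValue_eq_omegaMax (hn : 1 ≤ n) (hτ : ‖τ‖ = 1)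
    (hσ : ∀ k, ‖σ k‖ = 1) (hinj : Function.Injective σ) (hτσ : ∀ k, τ ≠ σ k) (hΛ : ∀ k, Λ k < 0)
    {G : ℂ → ℂ} (hG : G ∈ Gen τ σ Λ) (hG0 : G 0 ≠ 0) (hre : 0 < (ell τ σ Λ (G 0)).re)
    (hω : HasSpectralValueAt G τ (omegaMax τ σ Λ (G 0))) :
    EqOn G (paramGen τ σ Λ fun z => ((paramValue τ σ Λ (G 0))⁻¹ +
      ((paramValue τ σ Λ (G 0))⁻¹).re * (herglotz τ z - 1))⁻¹) disk := by
  have hS := sumInv_pos hn hΛ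
  rw [omegaMax_eq hτ hσ hτσ hre] at hω
  rw [← paramValue_re hτ hσ] at hre
  have hinv := inv_re_pos hre
  obtain ⟨h, hd, hpos, h0, heq⟩ := exists_eq_paramGen hn hτ hσ hinj hτσ hG hG0
  rw [← h0] at hω hre hinv ⊢
  have hpos' := re_pos_of_re_zero_pos hd hpos hre
  intro z hz
  rw [heq hz, paramGen, paramGen, ← eq_add_re_mul_herglotz_of_le (g := fun z => (h z)⁻¹) hτ
    (hd.inv fun z hz => ne_zero_of_re_pos (hpos' z hz)) (fun z hz => ?_) hz, inv_inv]
  have hjulia := herglotz_re_le_of_hasSpectralValueAt_paramGen hτ hσ hτσ hd hpos' (by positivity)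
    (hω.congr heq) hz
  rwa [inv_inv, add_sub_cancel_left, mul_inv, mul_inv_cancel_left₀ two_ne_zero,
    le_inv_mul_iff₀ hinv] at hjulia

end UpperBound


/-! ### Generators attaining the prescribed values -/

theorem existsUnique_herglotz_eq {τ : ℂ} (hτ : ‖τ‖ = 1) {κ : ℂ} (hκ : κ.re = 0) :
    ∃! s : ℂ, ‖s‖ = 1 ∧ s ≠ τ ∧ herglotz s τ = κ := by
  have hκ1 : κ - 1 ≠ 0 := fun h => by simpa [hκ] using congrArg Complex.re h
  have hτ0 := ne_zero_of_norm_one hτ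
  have hnorm : ‖κ + 1‖ = ‖κ - 1‖ := by
    have hsq := norm_sq_add_conj_sub_norm_sq_sub κ 1
    rw [hκ, map_one, mul_zero, zero_mul, sub_eq_zero] at hsq
    exact (pow_left_inj₀ (norm_nonneg _) (norm_nonneg _) two_ne_zero).1 hsq
  have hsub : τ * ((κ + 1) / (κ - 1)) - τ = 2 * τ / (κ - 1) := by
    field_simp
    ring
  refine ⟨τ * ((κ + 1) / (κ - 1)), ⟨?_, sub_ne_zero.1 ?_, ?_⟩, ?_⟩
  · rw [norm_mul, hτ, one_mul, norm_div, hnorm, div_self (norm_ne_zero_iff.2 hκ1)]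
  · rw [hsub]
    exact div_ne_zero (mul_ne_zero two_ne_zero hτ0) hκ1
  · rw [herglotz, hsub]
    field_simp
    ring
  · rintro s ⟨-, hsτ, hs⟩
    rw [herglotz, div_eq_iff (sub_ne_zero.2 hsτ)] at hs
    rw [← mul_div_assoc, eq_div_iff hκ1]
    linear_combination -hs

section Attained

variable {n : ℕ} {τ : ℂ} {σ : Fin n → ℂ} {Λ : Fin n → ℝ} {ζ : ℂ}

theorem existsUnique_extrDenom_eq_zero (hτ : ‖τ‖ = 1) (hσ : ∀ k, ‖σ k‖ = 1)
    (hre : 0 < (ell τ σ Λ ζ).re) :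
    ∃! s : ℂ, ‖s‖ = 1 ∧ s ≠ τ ∧ extrDenom τ σ Λ ζ s τ = 0 := by
  have hre0 : ((ell τ σ Λ ζ).re : ℂ) ≠ 0 := Complex.ofReal_ne_zero.2 hre.ne'
  have hκ : (-(Complex.I * ((ell τ σ Λ ζ).im : ℂ) + p0 τ σ Λ τ) / ((ell τ σ Λ ζ).re : ℂ)).re =
      0 := by
    rw [Complex.div_ofReal_re, Complex.neg_re, Complex.add_re, p0_boundary_re hτ hσ,
      Complex.re_mul_ofReal, Complex.I_re, zero_mul, add_zero, neg_zero, zero_div]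
  have hiff : ∀ s, extrDenom τ σ Λ ζ s τ = 0 ↔ herglotz s τ = _ := fun s => by
    rw [extrDenom, add_assoc, add_eq_zero_iff_eq_neg, ← eq_div_iff hre0, herglotz]
  simpa only [hiff] using existsUnique_herglotz_eq hτ hκ

theorem extrGen_eq_paramGen {s : ℂ} (h0 : extrDenom τ σ Λ ζ s τ = 0) :
    extrGen τ σ Λ ζ s =
      paramGen τ σ Λ fun z => ((ell τ σ Λ ζ).re : ℂ) * (herglotz s z - herglotz s τ) := by
  funext z
  rw [extrGen, paramGen]
  congr 1
  rw [extrDenom] at h0 ⊢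
  simp only [herglotz]
  linear_combination h0

theorem paramValue_eq_of_extrDenom_eq_zero {s : ℂ} (h0 : extrDenom τ σ Λ ζ s τ = 0) :
    paramValue τ σ Λ ζ = ((ell τ σ Λ ζ).re : ℂ) * (1 - herglotz s τ) := by
  rw [extrDenom, ← herglotz] at h0
  rw [paramValue]
  linear_combination h0 - Complex.re_add_im (ell τ σ Λ ζ)

theorem extrGen_mem (hn : 1 ≤ n) (hτ : ‖τ‖ = 1) (hσ : ∀ k, ‖σ k‖ = 1)
    (hinj : Function.Injective σ) (hτσ : ∀ k, τ ≠ σ k) (hΛ : ∀ k, Λ k < 0)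
    (hre : 0 < (ell τ σ Λ ζ).re) {s : ℂ} (hs : ‖s‖ = 1) (hsτ : s ≠ τ)
    (h0 : extrDenom τ σ Λ ζ s τ = 0) :
    extrGen τ σ Λ ζ s ∈ Gen τ σ Λ ∧ extrGen τ σ Λ ζ s 0 = ζ ∧
      HasSpectralValueAt (extrGen τ σ Λ ζ s) τ (omegaMax τ σ Λ ζ) := by
  have hvalue := paramValue_eq_of_extrDenom_eq_zero h0
  have hmax : omegaMax τ σ Λ ζ =
      (sumInv Λ + (ell τ σ Λ ζ).re * (2 / ‖τ - s‖ ^ 2))⁻¹ := by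
    rw [omegaMax_eq hτ hσ hτσ hre, hvalue, inv_mul_one_sub_herglotz_re hs hτ hsτ hre]
    congr 2
    field_simp
    norm_num
  obtain ⟨hmem, hsp⟩ := paramGen_herglotz_mem hn hτ hσ hinj hτσ hΛ hre.le hs hsτ
  rw [extrGen_eq_paramGen h0, hmax]
  exact ⟨hmem, paramGen_apply_zero hτ hσ (by rw [herglotz_zero hs, hvalue]), hsp⟩

theorem eqOn_extrGen_of_spectralValue_eq_omegaMax (hn : 1 ≤ n) (hτ : ‖τ‖ = 1)
    (hσ : ∀ k, ‖σ k‖ = 1) (hinj : Function.Injective σ) (hτσ : ∀ k, τ ≠ σ k) (hΛ : ∀ k, Λ k < 0)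
    (hζ : ζ ≠ 0) (hre : 0 < (ell τ σ Λ ζ).re) {s : ℂ} (hs : ‖s‖ = 1) (hsτ : s ≠ τ)
    (h0 : extrDenom τ σ Λ ζ s τ = 0) {G : ℂ → ℂ} (hG : G ∈ Gen τ σ Λ) (hG0 : G 0 = ζ)
    (hω : HasSpectralValueAt G τ (omegaMax τ σ Λ ζ)) : EqOn G (extrGen τ σ Λ ζ s) disk := by
  obtain ⟨hE, hE0, hEω⟩ := extrGen_mem hn hτ hσ hinj hτσ hΛ hre hs hsτ h0
  have hG_eq := eqOn_paramGen_of_spectralValue_eq_omegaMax hn hτ hσ hinj hτσ hΛ hG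
    (hG0 ▸ hζ) (hG0 ▸ hre) (hG0 ▸ hω)
  have hE_eq := eqOn_paramGen_of_spectralValue_eq_omegaMax hn hτ hσ hinj hτσ hΛ hE
    (by rwa [hE0]) (by rwa [hE0]) (by rwa [hE0])
  rw [hG0] at hG_eq
  rw [hE0] at hE_eq
  exact hG_eq.trans hE_eq.symm

theorem exists_mem_gen_of_lt_omegaMax (hn : 1 ≤ n) (hτ : ‖τ‖ = 1) (hσ : ∀ k, ‖σ k‖ = 1)
    (hinj : Function.Injective σ) (hτσ : ∀ k, τ ≠ σ k) (hΛ : ∀ k, Λ k < 0)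
    (hre : 0 < (ell τ σ Λ ζ).re) {ω : ℝ} (hω0 : 0 ≤ ω) (hω : ω < omegaMax τ σ Λ ζ) :
    ∃ G ∈ Gen τ σ Λ, G 0 = ζ ∧ HasSpectralValueAt G τ ω := by
  have hS := sumInv_pos hn hΛ
  rw [omegaMax_eq hτ hσ hτσ hre] at hω
  rw [← paramValue_re hτ hσ] at hre
  have hinv := inv_re_pos hre
  rcases hω0.eq_or_lt with rfl | hωpos
  · obtain ⟨hmem, hsp⟩ := paramGen_const_mem hn hτ hσ hinj hτσ hΛ (ne_zero_of_re_pos hre) hre.le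
    exact ⟨_, hmem, paramGen_apply_zero hτ hσ rfl, hsp⟩
  rw [lt_inv_comm₀ hωpos (by positivity), ← lt_sub_iff_add_lt'] at hω
  have hD : 0 < ω⁻¹ - sumInv Λ := lt_trans (by positivity) hω
  have hm : (2 * (ω⁻¹ - sumInv Λ))⁻¹ < ((paramValue τ σ Λ ζ)⁻¹).re := by
    rw [inv_lt_iff_one_lt_mul₀ (by positivity)] at hω ⊢
    linarith
  obtain ⟨hmem, hsp⟩ := paramGen_inv_mem hn hτ hσ hinj hτσ hΛ
    (b := (paramValue τ σ Λ ζ)⁻¹ - ((2 * (ω⁻¹ - sumInv Λ))⁻¹ : ℝ)) (inv_pos.2 (mul_pos two_pos hD))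
    (by rwa [Complex.sub_re, Complex.ofReal_re, sub_pos])
  have hsp_eq : (sumInv Λ + (2 * (2 * (ω⁻¹ - sumInv Λ))⁻¹)⁻¹)⁻¹ = ω := by
    rw [mul_inv, inv_inv, inv_mul_cancel_left₀ two_ne_zero, add_sub_cancel, inv_inv]
  rw [hsp_eq] at hsp
  refine ⟨_, hmem, paramGen_apply_zero hτ hσ ?_, hsp⟩
  rw [herglotz_zero hτ, mul_one, add_sub_cancel, inv_inv]

end Attained

/-! ### The disk of values at the origin -/

section Region

variable {n : ℕ} {τ : ℂ} {σ : Fin n → ℂ} {Λ : Fin n → ℝ} {ζ : ℂ}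

theorem norm_sumAlpha_mul_sub_one_sq (hτ : ‖τ‖ = 1) (ζ : ℂ) :
    ‖(2 * τ⁻¹ * (sumAlpha τ σ Λ : ℂ)) * ζ - 1‖ ^ 2 =
      1 - 4 * sumAlpha τ σ Λ * ‖ζ‖ ^ 2 * (ell τ σ Λ ζ).re := by
  rcases eq_or_ne ζ 0 with rfl | hζ
  · simp
  have hτ0 := ne_zero_of_norm_one hτ
  have hfactor : (2 * τ⁻¹ * (sumAlpha τ σ Λ : ℂ)) * ζ - 1 =
      ζ / τ * ((sumAlpha τ σ Λ : ℂ) - ell τ σ Λ ζ) := by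
    rw [ell]
    field_simp
    ring
  have hnorm : ‖(sumAlpha τ σ Λ : ℂ) + conj (ell τ σ Λ ζ)‖ = ‖ζ‖⁻¹ := by
    rw [ell, map_sub, Complex.conj_ofReal, add_sub_cancel, RCLike.norm_conj, norm_div, hτ, one_div]
  have hsq := norm_sq_add_conj_sub_norm_sq_sub (sumAlpha τ σ Λ : ℂ) (ell τ σ Λ ζ)
  have hcancel : ‖ζ‖⁻¹ ^ 2 * ‖ζ‖ ^ 2 = 1 := by
    rw [← mul_pow, inv_mul_cancel₀ (norm_ne_zero_iff.2 hζ), one_pow]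
  rw [hnorm, Complex.ofReal_re] at hsq
  rw [hfactor, norm_mul, norm_div, hτ, div_one, mul_pow]
  linear_combination hcancel - ‖ζ‖ ^ 2 * hsq

theorem norm_sumAlpha_mul_sub_one (hτ : ‖τ‖ = 1) (hA : 0 < sumAlpha τ σ Λ) (ζ : ℂ) :
    ‖(2 * τ⁻¹ * (sumAlpha τ σ Λ : ℂ)) * ζ - 1‖ =
      2 * sumAlpha τ σ Λ * dist ζ (τ / (2 * sumAlpha τ σ Λ)) := by
  have hτ0 := ne_zero_of_norm_one hτ
  have hA' := Complex.ofReal_ne_zero.2 hA.ne'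
  have hfactor : (2 * τ⁻¹ * (sumAlpha τ σ Λ : ℂ)) * ζ - 1 =
      ((2 * sumAlpha τ σ Λ : ℝ) : ℂ) * τ⁻¹ * (ζ - τ / (2 * sumAlpha τ σ Λ)) := by
    push_cast
    field_simp
  rw [hfactor, norm_mul, norm_mul, norm_inv, hτ, inv_one, mul_one, Complex.norm_real,
    Real.norm_of_nonneg (by positivity), dist_eq_norm]

theorem regionZ_eq_closedBall (hτ : ‖τ‖ = 1) (hA : 0 < sumAlpha τ σ Λ) :
    regionZ τ σ Λ = Metric.closedBall (τ / (2 * sumAlpha τ σ Λ)) (2 * sumAlpha τ σ Λ)⁻¹ := by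
  ext ζ
  rw [regionZ, mem_ofPred_eq, norm_sumAlpha_mul_sub_one hτ hA, Metric.mem_closedBall, ← one_div,
    le_div_iff₀' (by positivity)]

theorem mem_regionZ_iff (hτ : ‖τ‖ = 1) (hA : 0 < sumAlpha τ σ Λ) (hζ : ζ ≠ 0) :
    ζ ∈ regionZ τ σ Λ ↔ 0 ≤ (ell τ σ Λ ζ).re := by
  rw [regionZ, mem_ofPred_eq, ← sq_le_one_iff₀ (norm_nonneg _), norm_sumAlpha_mul_sub_one_sq hτ,
    sub_le_self_iff, mul_nonneg_iff_of_pos_left (by positivity)]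

theorem mem_interior_regionZ_iff (hτ : ‖τ‖ = 1) (hA : 0 < sumAlpha τ σ Λ) :
    ζ ∈ interior (regionZ τ σ Λ) ↔ ζ ≠ 0 ∧ 0 < (ell τ σ Λ ζ).re := by
  have h2A : 0 < 2 * sumAlpha τ σ Λ := by positivity
  rw [regionZ_eq_closedBall hτ hA, interior_closedBall _ (inv_pos.2 h2A).ne', Metric.mem_ball,
    ← one_div, lt_div_iff₀' h2A, ← norm_sumAlpha_mul_sub_one hτ hA,
    ← sq_lt_one_iff₀ (norm_nonneg _), norm_sumAlpha_mul_sub_one_sq hτ, sub_lt_self_iff]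
  rcases eq_or_ne ζ 0 with rfl | hζ
  · simp
  · rw [mul_pos_iff_of_pos_left (by positivity), and_iff_right hζ]

theorem mem_frontier_regionZ_iff (hτ : ‖τ‖ = 1) (hA : 0 < sumAlpha τ σ Λ) :
    ζ ∈ frontier (regionZ τ σ Λ) ↔ ζ = 0 ∨ (ell τ σ Λ ζ).re = 0 := by
  have h2A : 0 < 2 * sumAlpha τ σ Λ := by positivity
  rw [regionZ_eq_closedBall hτ hA, frontier_closedBall _ (inv_pos.2 h2A).ne', Metric.mem_sphere,
    ← one_div, eq_div_iff_mul_eq h2A.ne', mul_comm, ← norm_sumAlpha_mul_sub_one hτ hA,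
    ← pow_eq_one_iff_of_nonneg (norm_nonneg _) two_ne_zero, norm_sumAlpha_mul_sub_one_sq hτ,
    sub_eq_self]
  simp [hA.ne']

theorem apply_zero_mem_regionZ (hn : 1 ≤ n) (hτ : ‖τ‖ = 1) (hσ : ∀ k, ‖σ k‖ = 1)
    (hinj : Function.Injective σ) (hτσ : ∀ k, τ ≠ σ k) (hΛ : ∀ k, Λ k < 0) {G : ℂ → ℂ}
    (hG : G ∈ Gen τ σ Λ) : G 0 ∈ regionZ τ σ Λ := by
  rcases eq_or_ne (G 0) 0 with hG0 | hG0
  · rw [hG0]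
    simp [regionZ]
  · rw [mem_regionZ_iff hτ (sumAlpha_pos hn hτσ hΛ) hG0, ← paramValue_re hτ hσ]
    obtain ⟨h, -, hpos, h0, -⟩ := exists_eq_paramGen hn hτ hσ hinj hτσ hG hG0
    rw [← h0]
    exact hpos 0 zero_mem_disk

theorem sumAlpha_sub_p0 (hτσ : ∀ k, τ ≠ σ k) : (sumAlpha τ σ Λ : ℂ) - p0 τ σ Λ τ =
    τ * conj (∑ k, ((|Λ k|⁻¹ : ℝ) : ℂ) * (τ - σ k)) := by
  rw [sumAlpha, p0_eq, Complex.ofReal_sum, ← Finset.sum_sub_distrib, map_sum, Finset.mul_sum]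
  refine Finset.sum_congr rfl fun k _ => ?_
  have hsub := sub_ne_zero.2 (hτσ k)
  have halpha : (alpha τ σ Λ k : ℂ) =
      ((|Λ k|⁻¹ : ℝ) : ℂ) * ((τ - σ k) * conj (τ - σ k)) / 2 := by
    rw [Complex.mul_conj, Complex.normSq_eq_norm_sq, alpha, div_mul_eq_div_div, div_eq_inv_mul]
    push_cast
    ring
  rw [← mul_one_sub, one_sub_herglotz (hτσ k).symm, halpha, map_mul, Complex.conj_ofReal]
  field_simp

theorem paramValue_eq_zero_iff (hτ : ‖τ‖ = 1) (hτσ : ∀ k, τ ≠ σ k) :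
    paramValue τ σ Λ ζ = 0 ↔ 1 / conj ζ = ∑ k, ((|Λ k|⁻¹ : ℝ) : ℂ) * (τ - σ k) := by
  have hfactor : paramValue τ σ Λ ζ =
      τ * conj (1 / conj ζ - ∑ k, ((|Λ k|⁻¹ : ℝ) : ℂ) * (τ - σ k)) := by
    rw [paramValue, ell, map_sub, map_div₀, Complex.conj_conj, map_one, mul_sub,
      ← sumAlpha_sub_p0 hτσ]
    ring
  rw [hfactor, mul_eq_zero_iff_left (ne_zero_of_norm_one hτ), map_eq_zero, sub_eq_zero]

theorem sum_inv_mul_sub_ne_zero (hn : 1 ≤ n) (hτ : ‖τ‖ = 1) (hσ : ∀ k, ‖σ k‖ = 1)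
    (hτσ : ∀ k, τ ≠ σ k) (hΛ : ∀ k, Λ k < 0) :
    ∑ k, ((|Λ k|⁻¹ : ℝ) : ℂ) * (τ - σ k) ≠ 0 := by
  intro hsum
  have hre := congrArg Complex.re (sumAlpha_sub_p0 (Λ := Λ) hτσ)
  rw [hsum, map_zero, mul_zero, Complex.sub_re, p0_boundary_re hτ hσ, Complex.ofReal_re,
    sub_zero, Complex.zero_re] at hre
  exact (sumAlpha_pos hn hτσ hΛ).ne' hre

end Region

/-! ### The fibers of the value region -/

section Fibers

variable {n : ℕ} {τ : ℂ} {σ : Fin n → ℂ} {Λ : Fin n → ℝ} {ζ : ℂ}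

theorem existsUnique_spectralValue (hτ : ‖τ‖ = 1) {G : ℂ → ℂ} (hG : G ∈ Gen τ σ Λ) :
    ∃! ω : ℝ, HasSpectralValueAt G τ ω := by
  obtain ⟨ω, -, hω⟩ := exists_spectralValue hτ hG
  exact ⟨ω, hω, fun ω' hω' => hω'.unique hω⟩

theorem valueRegion_eq_setOf_mem_fiber (hn : 1 ≤ n) (hτ : ‖τ‖ = 1) (hσ : ∀ k, ‖σ k‖ = 1)
    (hinj : Function.Injective σ) (hτσ : ∀ k, τ ≠ σ k) (hΛ : ∀ k, Λ k < 0) :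
    valueRegion τ σ Λ =
      {v : ℂ × ℝ | v.1 ∈ regionZ τ σ Λ ∧ v.2 ∈ Prod.mk v.1 ⁻¹' valueRegion τ σ Λ} := by
  ext ⟨ζ, ω⟩
  refine ⟨fun hv => ⟨?_, hv⟩, fun hv => hv.2⟩
  obtain ⟨G, hG, hG0, -⟩ := hv
  exact hG0 ▸ apply_zero_mem_regionZ hn hτ hσ hinj hτσ hΛ hG

theorem fiber_of_mem_interior (hn : 1 ≤ n) (hτ : ‖τ‖ = 1) (hσ : ∀ k, ‖σ k‖ = 1)
    (hinj : Function.Injective σ) (hτσ : ∀ k, τ ≠ σ k) (hΛ : ∀ k, Λ k < 0)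
    (hζ : ζ ∈ interior (regionZ τ σ Λ)) :
    Prod.mk ζ ⁻¹' valueRegion τ σ Λ = Icc 0 (omegaMax τ σ Λ ζ) := by
  obtain ⟨hζ0, hre⟩ := (mem_interior_regionZ_iff hτ (sumAlpha_pos hn hτσ hΛ)).1 hζ
  ext ω
  constructor
  · rintro ⟨G, hG, rfl : G 0 = ζ, hω⟩
    exact ⟨spectralValue_nonneg hτ hG hω,
      spectralValue_le_omegaMax hn hτ hσ hinj hτσ hΛ hG hζ0 hre hω⟩
  · rintro ⟨hω0, hω⟩
    rcases hω.eq_or_lt with rfl | hω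
    · obtain ⟨s, hs, hsτ, hs0⟩ := (existsUnique_extrDenom_eq_zero hτ hσ hre).exists
      exact ⟨_, extrGen_mem hn hτ hσ hinj hτσ hΛ hre hs hsτ hs0⟩
    · exact exists_mem_gen_of_lt_omegaMax hn hτ hσ hinj hτσ hΛ hre hω0 hω

theorem eqOn_paramGen_const_of_re_eq_zero (hn : 1 ≤ n) (hτ : ‖τ‖ = 1) (hσ : ∀ k, ‖σ k‖ = 1)
    (hinj : Function.Injective σ) (hτσ : ∀ k, τ ≠ σ k) {G : ℂ → ℂ} (hG : G ∈ Gen τ σ Λ)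
    (hG0 : G 0 ≠ 0) (hre : (ell τ σ Λ (G 0)).re = 0) :
    EqOn G (paramGen τ σ Λ fun _ => paramValue τ σ Λ (G 0)) disk := by
  obtain ⟨h, hd, hpos, h0, heq⟩ := exists_eq_paramGen hn hτ hσ hinj hτσ hG hG0
  rw [← paramValue_re hτ hσ, ← h0] at hre
  intro z hz
  rw [heq hz, paramGen, paramGen, ← h0, eq_of_re_eq_zero hd hpos zero_mem_disk hre z hz]

theorem spectralValue_eq_zero_of_apply_zero (hn : 1 ≤ n) (hτ : ‖τ‖ = 1) (hσ : ∀ k, ‖σ k‖ = 1)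
    (hτσ : ∀ k, τ ≠ σ k) (hΛ : ∀ k, Λ k < 0) {G : ℂ → ℂ} {ω : ℝ} (hG : G ∈ Gen τ σ Λ)
    (hG0 : G 0 = 0) (hω : HasSpectralValueAt G τ ω) : ω = 0 := by
  rcases eq_zero_or_berksonPorta_re_pos hn hτ hσ hτσ hG with hzero | hpos
  · exact (hω.congr (G' := fun _ => 0) hzero).unique (zero_mem_gen hτ hσ fun k => (hΛ k).le).2
  · simpa [berksonPorta, hG0] using hpos 0 zero_mem_disk

theorem fiber_zero (hn : 1 ≤ n) (hτ : ‖τ‖ = 1) (hσ : ∀ k, ‖σ k‖ = 1) (hτσ : ∀ k, τ ≠ σ k)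
    (hΛ : ∀ k, Λ k < 0) : Prod.mk 0 ⁻¹' valueRegion τ σ Λ = {0} := by
  ext ω
  constructor
  · rintro ⟨G, hG, hG0, hω⟩
    exact spectralValue_eq_zero_of_apply_zero hn hτ hσ hτσ hΛ hG hG0 hω
  · rintro rfl
    obtain ⟨hmem, hsp⟩ := zero_mem_gen hτ hσ fun k => (hΛ k).le
    exact ⟨_, hmem, rfl, hsp⟩

theorem fiber_of_paramGen_const_mem (hn : 1 ≤ n) (hτ : ‖τ‖ = 1) (hσ : ∀ k, ‖σ k‖ = 1)
    (hinj : Function.Injective σ) (hτσ : ∀ k, τ ≠ σ k) {ω : ℝ} (hζ : ζ ≠ 0)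
    (hre : (ell τ σ Λ ζ).re = 0)
    (hmem : paramGen τ σ Λ (fun _ => paramValue τ σ Λ ζ) ∈ Gen τ σ Λ)
    (hsp : HasSpectralValueAt (paramGen τ σ Λ fun _ => paramValue τ σ Λ ζ) τ ω) :
    Prod.mk ζ ⁻¹' valueRegion τ σ Λ = {ω} := by
  ext ω'
  constructor
  · rintro ⟨G, hG, rfl : G 0 = ζ, hω⟩
    exact (hω.congr (eqOn_paramGen_const_of_re_eq_zero hn hτ hσ hinj hτσ hG hζ hre)).unique hsp
  · rintro rfl
    exact ⟨_, hmem, paramGen_apply_zero hτ hσ rfl, hsp⟩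

theorem fiber_of_mem_frontier (hn : 1 ≤ n) (hτ : ‖τ‖ = 1) (hσ : ∀ k, ‖σ k‖ = 1)
    (hinj : Function.Injective σ) (hτσ : ∀ k, τ ≠ σ k) (hΛ : ∀ k, Λ k < 0)
    (hζ : ζ ∈ frontier (regionZ τ σ Λ)) :
    (1 / conj ζ = ∑ k, ((|Λ k|⁻¹ : ℝ) : ℂ) * (τ - σ k) →
      Prod.mk ζ ⁻¹' valueRegion τ σ Λ = {(sumInv Λ)⁻¹}) ∧
    (1 / conj ζ ≠ ∑ k, ((|Λ k|⁻¹ : ℝ) : ℂ) * (τ - σ k) →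
      Prod.mk ζ ⁻¹' valueRegion τ σ Λ = {0}) := by
  rcases eq_or_ne ζ 0 with rfl | hζ0
  · -- At `ζ = 0` the junk value `1 / conj ζ = 0` satisfies the inequality of the second case.
    refine ⟨fun h => ?_, fun _ => fiber_zero hn hτ hσ hτσ hΛ⟩
    rw [map_zero, div_zero] at h
    exact absurd h.symm (sum_inv_mul_sub_ne_zero hn hτ hσ hτσ hΛ)
  have hre := ((mem_frontier_regionZ_iff hτ (sumAlpha_pos hn hτσ hΛ)).1 hζ).resolve_left hζ0
  have hfiber := fun {ω : ℝ} =>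
    fiber_of_paramGen_const_mem (ω := ω) hn hτ hσ hinj hτσ hζ0 hre
  rw [Ne, ← paramValue_eq_zero_iff hτ hτσ]
  refine ⟨fun h => ?_, fun h => ?_⟩
  · obtain ⟨hmem, hsp⟩ := paramGen_zero_mem hn hτ hσ hinj hτσ hΛ
    rw [← h] at hmem hsp
    exact hfiber hmem hsp
  · obtain ⟨hmem, hsp⟩ := paramGen_const_mem hn hτ hσ hinj hτσ hΛ h
      ((paramValue_re hτ hσ ζ).trans hre).ge
    exact hfiber hmem hsp

end Fibers

end HolSemigroup

end

theorem mainTheorem4 {n : ℕ} (hn : 1 ≤ n) (τ : ℂ) (σ : Fin n → ℂ) (Λ : Fin n → ℝ)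
    (hτ : ‖τ‖ = 1) (hσ : ∀ k, ‖σ k‖ = 1) (hσ_inj : Function.Injective σ)
    (hτσ : ∀ k, τ ≠ σ k) (hΛ : ∀ k, Λ k < 0) :
    -- the spectral value at `τ` is well defined on the class
    (∀ G ∈ Gen τ σ Λ, ∃! ω : ℝ, HasSpectralValueAt G τ ω) ∧
    -- the value region
    (∃ I : ℂ → Set ℝ,
      valueRegion τ σ Λ = {v : ℂ × ℝ | v.1 ∈ regionZ τ σ Λ ∧ v.2 ∈ I v.1} ∧
      (∀ ζ ∈ interior (regionZ τ σ Λ), I ζ = Set.Icc 0 (omegaMax τ σ Λ ζ)) ∧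
      (∀ ζ ∈ frontier (regionZ τ σ Λ),
        (1 / (starRingEnd ℂ) ζ = ∑ k, ((|Λ k|⁻¹ : ℝ) : ℂ) * (τ - σ k) →
          I ζ = {(sumInv Λ)⁻¹}) ∧
        (1 / (starRingEnd ℂ) ζ ≠ ∑ k, ((|Λ k|⁻¹ : ℝ) : ℂ) * (τ - σ k) →
          I ζ = {0}))) ∧
    -- the unique generator with maximal spectral value
    (∀ ζ ∈ interior (regionZ τ σ Λ),
      (∃! s : ℂ, ‖s‖ = 1 ∧ s ≠ τ ∧ extrDenom τ σ Λ ζ s τ = 0) ∧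
      ∀ s : ℂ, ‖s‖ = 1 → s ≠ τ → extrDenom τ σ Λ ζ s τ = 0 →
        (extrGen τ σ Λ ζ s ∈ Gen τ σ Λ ∧ extrGen τ σ Λ ζ s 0 = ζ ∧
          HasSpectralValueAt (extrGen τ σ Λ ζ s) τ (omegaMax τ σ Λ ζ)) ∧
        ∀ G ∈ Gen τ σ Λ, G 0 = ζ → HasSpectralValueAt G τ (omegaMax τ σ Λ ζ) →
          Set.EqOn G (extrGen τ σ Λ ζ s) disk) := by
  refine ⟨fun G hG => existsUnique_spectralValue hτ hG,
    ⟨fun ζ => Prod.mk ζ ⁻¹' valueRegion τ σ Λ,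
      valueRegion_eq_setOf_mem_fiber hn hτ hσ hσ_inj hτσ hΛ,
      fun ζ hζ => fiber_of_mem_interior hn hτ hσ hσ_inj hτσ hΛ hζ,
      fun ζ hζ => fiber_of_mem_frontier hn hτ hσ hσ_inj hτσ hΛ hζ⟩,
    fun ζ hζ => ?_⟩
  obtain ⟨hζ0, hre⟩ := (mem_interior_regionZ_iff hτ (sumAlpha_pos hn hτσ hΛ)).1 hζ
  exact ⟨existsUnique_extrDenom_eq_zero hτ hσ hre, fun s hs hsτ h0 =>
    ⟨extrGen_mem hn hτ hσ hσ_inj hτσ hΛ hre hs hsτ h0, fun G hG hG0 hω =>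
      eqOn_extrGen_of_spectralValue_eq_omegaMax hn hτ hσ hσ_inj hτσ hΛ hζ0 hre hs hsτ h0
        hG hG0 hω⟩⟩
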